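/- A convex polytope is the convex hull of a finite set of points in some $\mathbb{R}^N$; its dimension is the dimension of its affine hull. A face of a convex polytope $P \subset \mathbb{R}^N$ is either the empty set or the set of points of $P$ at which some linear functional on $\mathbb{R}^N$ attains its minimum over $P$ (so $P$ itself is a face of $P$); the empty face has dimension $-1$. For a nonnegative integer $k$, let $\mathcal{G}_k(P)$ be the simple graph whose nodes are the $k$-dimensional faces of $P$, two distinct nodes being adjacent if some $(k+1)$-dimensional face of $P$ contains them both. For a positive integer $m$, a graph is $m$-connected if it has at least $m+1$ nodes and every graph obtained from it by deleting at most $m-1$ nodes, with their incident edges, is connected. **Theorem.** Let $k$ and $d$ be integers with $0 \le k \le d-1$. There is a largest positive integer $m$ such that $\mathcal{G}_k(P)$ is $m$-connected for all convex polytopes $P$ of dimension $d$, and this integer $m_k(d)$ is $$m_k(d) = \begin{cases} d, & \text{if } k = d-2, \\ (k+1)(d-k), & \text{otherwise.} \end{cases}$$ -/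

import Mathlib

namespace PolytopeGraph

/-- A convex polytope: the convex hull of a finite set of points of `E`. -/
def IsPolytope {E : Type*} [AddCommGroup E] [Module ℝ E] (P : Set E) : Prop :=
  ∃ s : Set E, s.Finite ∧ P = convexHull ℝ s

/-- `S` is nonempty and its affine hull has dimension `d` (the empty set has dimension `-1`, so it
does not have dimension `d` for any natural number `d`). -/
def HasDim {E : Type*} [AddCommGroup E] [Module ℝ E] (S : Set E) (d : ℕ) : Prop :=
  S.Nonempty ∧ Module.finrank ℝ (affineSpan ℝ S).direction = d

/-- `F` is a `k`-dimensional face of `P`. Mathlib's `IsExposed ℝ P F` says that `F` is empty or the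
set of the points of `P` at which some (continuous) linear functional is maximal on `P`; replacing
the functional by its negative, this is the same as being a set of minimizers. -/
def IsFaceOfDim {E : Type*} [AddCommGroup E] [Module ℝ E] [TopologicalSpace E]
    (P : Set E) (k : ℕ) (F : Set E) : Prop :=
  IsExposed ℝ P F ∧ HasDim F k

/-- The graph `G_k(P)`: its nodes are the `k`-dimensional faces of `P`, and two distinct ones are
adjacent if some `(k+1)`-dimensional face of `P` contains both. -/
def faceGraph {E : Type*} [AddCommGroup E] [Module ℝ E] [TopologicalSpace E]
    (P : Set E) (k : ℕ) : SimpleGraph {F : Set E // IsFaceOfDim P k F} where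
  Adj F G := F ≠ G ∧ ∃ H : Set E, IsFaceOfDim P (k + 1) H ∧ F.1 ⊆ H ∧ G.1 ⊆ H
  symm := ⟨fun _ _ h => ⟨h.1.symm, h.2.imp fun _ hH => ⟨hH.1, hH.2.2, hH.2.1⟩⟩⟩
  loopless := ⟨fun _ h => h.1 rfl⟩

/-- `m`-connectedness of a graph (`m` a positive integer): there are at least `m + 1` nodes, and
deleting any set of at most `m - 1` nodes leaves a connected graph. -/
def IsVertexConnected {V : Type*} (G : SimpleGraph V) (m : ℕ) : Prop :=
  ((m + 1 : ℕ) : ℕ∞) ≤ ENat.card V ∧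
    ∀ S : Finset V, S.card ≤ m - 1 → (G.induce ((S : Set V)ᶜ)).Connected

end PolytopeGraph

/-! Placing the polytope at height one turns its faces into zero sets, on a finite vector
configuration, of linear functionals that are nonnegative there; dimension becomes rank minus one
and the empty face has rank 0. All connectivity arguments take place in the faces above a fixed face
`F`, so that passing to a vertex figure only means replacing `F` by an atom above it.

The lower bound `linked_nodes` is an induction on `k`; the case `k = 0` is Balinski's theorem,
`linked_of_card_lt`. Let `U` be the deleted faces, and call an atom good if fewer than `bound (k -
1) (n - 1)` members of `U` contain it. By induction the surviving faces through a good atom are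
linked to each other. Every surviving face contains a good atom (`exists_atom_card_lt`). If two
surviving faces were not linked, the good atoms would split into two sides. When `k ≥ 2` or `n = k +
2`, the bad atoms lie in one proper face (`exists_face_of_card_le`), so the good ones are linked and
some edge joins good atoms on opposite sides. By `choose_le_card_touching` this forces at least
`n.choose k` deletions, which is too many. For `k = 1` and `n ≥ 4` that number is too small, and
`edge_partition_false` finishes by a finer count of edges between the two sides.

For optimality, a `k`-face of a simplex has at most `(k + 1) * (d - k)` neighbors. When `k = d - 2`,
deleting the `d` ridges of a bipyramid over a simplex that avoid both apexes separates the ridges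
through one apex from those through the other. -/

namespace VectorConfiguration

set_option linter.unusedSectionVars false

open Module Submodule PolytopeGraph
open scoped Classical

/-! ### The face lattice of a vector configuration. -/

section Faces

variable {W : Type*} [AddCommGroup W] [Module ℝ W] [FiniteDimensional ℝ W]
  {ι : Type*} [Fintype ι] (v : ι → W)

/-- `S` is the set of indices at which some linear functional that is nonnegative on the
configuration `v` vanishes. -/
def Face (S : Finset ι) : Prop :=
  ∃ f : Dual ℝ W, (∀ i, 0 ≤ f (v i)) ∧ ∀ i, i ∈ S ↔ f (v i) = 0

/-- The rank of a subconfiguration. -/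
noncomputable def rk (S : Finset ι) : ℕ := finrank ℝ (span ℝ (v '' (S : Set ι)))

variable {v}

lemma face_univ : Face v Finset.univ := ⟨0, by simp, by simp⟩

lemma Face.inter {S T : Finset ι} (hS : Face v S) (hT : Face v T) : Face v (S ∩ T) := by
  obtain ⟨f, hf, hfS⟩ := hS
  obtain ⟨g, hg, hgT⟩ := hT
  refine ⟨f + g, fun i => add_nonneg (hf i) (hg i), fun i => ?_⟩
  rw [Finset.mem_inter, hfS, hgT, LinearMap.add_apply, add_eq_zero_iff_of_nonneg (hf i) (hg i)]

lemma span_le_ker {S : Finset ι} {g : Dual ℝ W} (hg : ∀ i ∈ S, g (v i) = 0) :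
    span ℝ (v '' (S : Set ι)) ≤ LinearMap.ker g := by
  rw [span_le]
  rintro _ ⟨i, hi, rfl⟩
  exact hg i hi

lemma rk_mono {S T : Finset ι} (h : S ⊆ T) : rk v S ≤ rk v T :=
  Submodule.finrank_mono (span_mono (Set.image_mono (by exact_mod_cast h)))

lemma Face.rk_lt {S T : Finset ι} (hS : Face v S) (h : S ⊂ T) : rk v S < rk v T := by
  obtain ⟨f, -, hf⟩ := hS
  obtain ⟨hle, i, hiT, hiS⟩ := Finset.ssubset_iff_exists_cons_subset.1 h |>.elim fun a ha =>
    (⟨h.1, a, ha.elim fun _ h2 => h2 (Finset.mem_cons_self _ _), ha.elim fun h1 _ => h1⟩ :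
      S ⊆ T ∧ ∃ i, i ∈ T ∧ i ∉ S)
  refine Submodule.finrank_lt_finrank_of_lt
    (lt_of_le_of_ne (span_mono (Set.image_mono (by exact_mod_cast hle))) fun heq => ?_)
  have h1 : v i ∈ span ℝ (v '' (S : Set ι)) := heq ▸ subset_span ⟨i, hiT, rfl⟩
  exact hiS ((hf i).2 (span_le_ker (fun j hj => (hf j).1 hj) h1))

lemma Face.eq_of_rk_le {S T : Finset ι} (hS : Face v S) (h : S ⊆ T) (hr : rk v T ≤ rk v S) :
    S = T := by
  by_contra hne
  exact absurd (hS.rk_lt (h.ssubset_of_ne hne)) (not_lt.2 hr)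

/-- A face of a face is a face. -/
lemma Face.relative {T : Finset ι} (hT : Face v T) (f : Dual ℝ W) (hf : ∀ i ∈ T, 0 ≤ f (v i)) :
    Face v (T.filter fun i => f (v i) = 0) := by
  obtain ⟨g, hg, hgT⟩ := hT
  -- A multiple of `g` large enough to make `f` positive off `T`; for `i ∈ T` the denominator is
  -- zero and the summand is 0 by convention.
  set M : ℝ := ∑ i, (|f (v i)| + 1) / g (v i) with hM
  have hpos : ∀ i ∉ T, 0 < (f + M • g) (v i) := by
    intro i hi
    have hgi : 0 < g (v i) := lt_of_le_of_ne (hg i) (fun h => hi ((hgT i).2 h.symm))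
    have h1 : (|f (v i)| + 1) / g (v i) ≤ M :=
      Finset.single_le_sum (f := fun i => (|f (v i)| + 1) / g (v i))
        (fun j _ => div_nonneg (by positivity) (hg j)) (Finset.mem_univ i)
    rw [div_le_iff₀ hgi] at h1
    have := neg_abs_le (f (v i))
    simp only [LinearMap.add_apply, LinearMap.smul_apply, smul_eq_mul]
    linarith
  have hin : ∀ i ∈ T, (f + M • g) (v i) = f (v i) := by
    intro i hi
    simp [(hgT i).1 hi]
  refine ⟨f + M • g, fun i => ?_, fun i => ?_⟩
  · by_cases hi : i ∈ T
    · rw [hin i hi]; exact hf i hi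
    · exact (hpos i hi).le
  · rw [Finset.mem_filter]
    by_cases hi : i ∈ T
    · rw [hin i hi]; simp [hi]
    · simpa [hi] using (hpos i hi).ne'

/-- Tilting a functional that is nonnegative on `T` towards `g` until it vanishes somewhere
new. -/
lemma Face.pivot {T : Finset ι} (hT : Face v T) (f g : Dual ℝ W) (hf : ∀ i ∈ T, 0 ≤ f (v i))
    (hfg : ∀ i ∈ T, 0 < g (v i) → 0 < f (v i)) (hg : ∃ i ∈ T, 0 < g (v i)) :
    ∃ t : ℝ, 0 < t ∧ Face v (T.filter fun i => f (v i) = t * g (v i)) ∧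
      ∃ i ∈ T, 0 < g (v i) ∧ f (v i) = t * g (v i) := by
  obtain ⟨i₀, hi₀, hgi₀⟩ := hg
  -- The ratio test of the simplex method: `t` is the least `f / g` where `g > 0`.
  obtain ⟨j, hj, hmin⟩ := Finset.exists_min_image (T.filter fun i => 0 < g (v i))
    (fun i => f (v i) / g (v i)) ⟨i₀, by simp [hi₀, hgi₀]⟩
  rw [Finset.mem_filter] at hj
  have hfj := hfg j hj.1 hj.2
  refine ⟨f (v j) / g (v j), div_pos hfj hj.2, ?_, j, hj.1, hj.2, ?_⟩
  · have := hT.relative (f - (f (v j) / g (v j)) • g) ?_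
    · simpa [sub_eq_zero] using this
    · intro i hi
      simp only [LinearMap.sub_apply, LinearMap.smul_apply, smul_eq_mul, sub_nonneg]
      rcases le_or_gt (g (v i)) 0 with h | h
      · exact (mul_nonpos_of_nonneg_of_nonpos (div_pos hfj hj.2).le h).trans (hf i hi)
      · rw [← le_div_iff₀ h]
        exact hmin i (by simp [hi, h])
  · field_simp [hj.2.ne']

lemma exists_dual_of_rk_lt {T : Finset ι} {p : Submodule ℝ W} (h : finrank ℝ p < rk v T) :
    ∃ g : Dual ℝ W, p ≤ LinearMap.ker g ∧ ∃ i ∈ T, 0 < g (v i) := by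
  have : ∃ i ∈ T, v i ∉ p := by
    by_contra! hcon
    have : span ℝ (v '' (T : Set ι)) ≤ p := by
      rw [span_le]
      rintro _ ⟨i, hi, rfl⟩
      exact hcon i hi
    exact absurd (Submodule.finrank_mono this) (not_le.2 h)
  obtain ⟨i, hi, hip⟩ := this
  obtain ⟨g, hg, hgp⟩ := Submodule.exists_le_ker_of_notMem hip
  rcases lt_or_gt_of_ne hg with h0 | h0
  · refine ⟨-g, fun x hx => ?_, i, hi, by simpa using h0⟩
    simpa using hgp hx
  · exact ⟨g, hgp, i, hi, h0⟩

lemma finrank_sup_span_singleton_le (p : Submodule ℝ W) (x : W) :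
    finrank ℝ (p ⊔ span ℝ {x} : Submodule ℝ W) ≤ finrank ℝ p + 1 :=
  (Submodule.finrank_add_le_finrank_add_finrank _ _).trans
    (Nat.add_le_add_left ((finrank_span_le_card ({x} : Set W)).trans (by simp)) _)

/-- The face lattice is graded: a face can be enlarged by one rank inside any larger face. -/
lemma exists_face_rk_succ {S T : Finset ι} (hS : Face v S) (hT : Face v T) (h : S ⊂ T) :
    ∃ A, Face v A ∧ S ⊆ A ∧ A ⊆ T ∧ rk v A = rk v S + 1 := by
  induction hn : T.card using Nat.strong_induction_on generalizing T with
  | _ n ih =>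
  have hlt := hS.rk_lt h
  by_cases hr : rk v T = rk v S + 1
  · exact ⟨T, hT, h.1, subset_rfl, hr⟩
  obtain ⟨f, hf, hfS⟩ := id hS
  obtain ⟨j, hjT, hjS⟩ := Finset.exists_of_ssubset h
  -- As `g` kills `S` and `v j`, pivoting gives a face that gains a point over `S` but loses `j`,
  -- hence strictly between `S` and `T`.
  obtain ⟨g, hgp, i, hi, hgi⟩ := exists_dual_of_rk_lt (v := v) (T := T)
    (p := span ℝ (v '' (S : Set ι)) ⊔ span ℝ {v j}) (by
      have := finrank_sup_span_singleton_le (span ℝ (v '' (S : Set ι))) (v j)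
      unfold rk at *
      omega)
  have hgS : ∀ i ∈ S, g (v i) = 0 := fun i hi =>
    hgp (Submodule.mem_sup_left (subset_span ⟨i, hi, rfl⟩))
  have hgj : g (v j) = 0 := hgp (Submodule.mem_sup_right (subset_span rfl))
  have hpos : ∀ i ∉ S, 0 < f (v i) := fun i hi =>
    lt_of_le_of_ne (hf i) fun h => hi ((hfS i).2 h.symm)
  obtain ⟨t, ht, hface, l, hlT, hgl, hfl⟩ := hT.pivot f g (fun i _ => hf i)
    (fun i _ hgi => hpos i fun hiS => hgi.ne' (hgS i hiS)) ⟨i, hi, hgi⟩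
  set T' := T.filter fun i => f (v i) = t * g (v i)
  have hST' : S ⊂ T' := by
    refine Finset.ssubset_iff_of_subset (fun i hi => ?_) |>.2 ⟨l, ?_, fun hlS => ?_⟩
    · simp [T', h.1 hi, hgS i hi, (hfS i).1 hi]
    · simp [T', hlT, hfl]
    · exact hgl.ne' (hgS l hlS)
  have hT'T : T' ⊂ T := by
    refine Finset.ssubset_iff_of_subset (Finset.filter_subset _ _) |>.2 ⟨j, hjT, fun hj => ?_⟩
    have := (Finset.mem_filter.1 hj).2
    rw [hgj, mul_zero] at this
    exact hjS ((hfS j).2 this)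
  obtain ⟨A, hA, h1, h2, h3⟩ := ih _ (hn ▸ Finset.card_lt_card hT'T) hface hST' rfl
  exact ⟨A, hA, h1, h2.trans hT'T.1, h3⟩

/-- Every interval of length two in the face lattice has at least two middle elements. -/
lemma exists_other_face {S A T : Finset ι} (hS : Face v S) (hA : Face v A) (hT : Face v T)
    (hSA : S ⊆ A) (hAT : A ⊆ T) (hr : rk v A = rk v S + 1) (hr' : rk v T = rk v S + 2) :
    ∃ A', Face v A' ∧ A' ≠ A ∧ S ⊆ A' ∧ A' ⊆ T ∧ rk v A' = rk v S + 1 := by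
  obtain ⟨f, hf, hfS⟩ := id hS
  obtain ⟨g, hg, hgA⟩ := id hA
  have hposf : ∀ i ∉ S, 0 < f (v i) := fun i hi =>
    lt_of_le_of_ne (hf i) fun h => hi ((hfS i).2 h.symm)
  have hposg : ∀ i ∉ A, 0 < g (v i) := fun i hi =>
    lt_of_le_of_ne (hg i) fun h => hi ((hgA i).2 h.symm)
  have hgS : ∀ i ∈ S, g (v i) = 0 := fun i hi => (hgA i).1 (hSA hi)
  have hSA' : S ⊂ A := hSA.ssubset_of_ne (by rintro rfl; omega)
  have hAT' : A ⊂ T := hAT.ssubset_of_ne (by rintro rfl; omega)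
  obtain ⟨a, haA, haS⟩ := Finset.exists_of_ssubset hSA'
  obtain ⟨b, hbT, hbA⟩ := Finset.exists_of_ssubset hAT'
  -- Tilting the support of `S` towards that of `A` reaches a point outside `A`, while `a ∈ A` is
  -- left out because `g` vanishes there and `f` does not.
  obtain ⟨t, ht, hface, l, hlT, hgl, hfl⟩ := hT.pivot f g (fun i _ => hf i)
    (fun i _ hgi => hposf i fun hiS => hgi.ne' (hgS i hiS)) ⟨b, hbT, hposg b hbA⟩
  set T' := T.filter fun i => f (v i) = t * g (v i) with hT'
  have haT' : a ∉ T' := fun h => by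
    have := (Finset.mem_filter.1 h).2
    rw [(hgA a).1 haA, mul_zero] at this
    exact haS ((hfS a).2 this)
  have hlT' : l ∈ T' := by simp [hT', hlT, hfl]
  have hlA : l ∉ A := fun h => hgl.ne' ((hgA l).1 h)
  have hST' : S ⊂ T' := by
    refine Finset.ssubset_iff_of_subset (fun i hi => ?_) |>.2 ⟨l, hlT', fun hlS => hlA (hSA hlS)⟩
    simp [hT', hAT (hSA hi), hgS i hi, (hfS i).1 hi]
  have hT'T : T' ⊂ T :=
    Finset.ssubset_iff_of_subset (Finset.filter_subset _ _) |>.2 ⟨a, hAT haA, haT'⟩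
  have h1 := hS.rk_lt hST'
  have h2 := hface.rk_lt hT'T
  exact ⟨T', hface, fun h => haT' (h ▸ haA), hST'.1, hT'T.1, by omega⟩

lemma exists_coface_rk_succ {S T : Finset ι} (hS : Face v S) (hT : Face v T) (h : S ⊂ T) :
    ∃ C, Face v C ∧ S ⊆ C ∧ C ⊆ T ∧ rk v C + 1 = rk v T := by
  obtain ⟨C, hC⟩ := Finset.exists_maximal
    (s := Finset.univ.filter fun C : Finset ι => Face v C ∧ S ⊆ C ∧ C ⊂ T) ⟨S, by simp [hS, h]⟩
  have hC1 := hC.1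
  simp only [Finset.mem_filter, Finset.mem_univ, true_and] at hC1
  obtain ⟨A, hA, h1, h2, h3⟩ := exists_face_rk_succ hC1.1 hT hC1.2.2
  have hAT : A = T := by
    by_contra hne
    have : A ≤ C := hC.2 (by simp [hA, hC1.2.1.trans h1, h2.ssubset_of_ne hne]) h1
    have := rk_mono (v := v) this
    omega
  exact ⟨C, hC1.1, hC1.2.1, hC1.2.2.1, by rw [← hAT, h3]⟩

/-- An atom of an interval has a complement of corank one. -/
lemma exists_coface_not_superset {F A T : Finset ι} (hF : Face v F) (hT : Face v T)
    (hFA : F ⊂ A) (hAT : A ⊆ T) :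
    ∃ C, Face v C ∧ F ⊆ C ∧ C ⊆ T ∧ rk v C + 1 = rk v T ∧ ¬ A ⊆ C := by
  obtain ⟨C, hC⟩ := Finset.exists_maximal
    (s := Finset.univ.filter fun C : Finset ι => Face v C ∧ F ⊆ C ∧ C ⊆ T ∧ ¬ A ⊆ C)
    ⟨F, by simp [hF, hFA.1.trans hAT, hFA.2]⟩
  have hC1 := hC.1
  simp only [Finset.mem_filter, Finset.mem_univ, true_and] at hC1
  obtain ⟨hCf, hFC, hCT, hAC⟩ := hC1
  have hmax : ∀ B, Face v B → C ⊂ B → B ⊆ T → A ⊆ B := fun B hB h1 h2 => by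
    by_contra hcon
    exact h1.2 (hC.2 (by simp [hB, hFC.trans h1.1, h2, hcon]) h1.1)
  refine ⟨C, hCf, hFC, hCT, ?_, hAC⟩
  have hCT' : C ⊂ T := hCT.ssubset_of_ne (by rintro rfl; exact hAC hAT)
  obtain ⟨B, hB, h1, h2, h3⟩ := exists_face_rk_succ hCf hT hCT'
  by_cases hBT : B = T
  · rw [← hBT, h3]
  -- Otherwise the interval from `C` to `D` has length two. By maximality of `C` both of its middle
  -- elements `B` and `B'` contain `A`, yet they meet in `C`.
  exfalso
  obtain ⟨D, hD, h4, h5, h6⟩ := exists_face_rk_succ hB hT (h2.ssubset_of_ne hBT)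
  obtain ⟨B', hB', h7, h8, h9, h10⟩ := exists_other_face hCf hB hD h1 h4 h3 (by omega)
  have hs : ∀ X : Finset ι, C ⊆ X → rk v X = rk v C + 1 → C ⊂ X := fun X hX hr =>
    hX.ssubset_of_ne (by rintro rfl; omega)
  have hAB := hmax B hB (hs B h1 h3) h2
  have hAB' := hmax B' hB' (hs B' h8 h10) (h9.trans h5)
  have hne : B ∩ B' ≠ B := fun h =>
    h7 (hB.eq_of_rk_le (Finset.inter_eq_left.1 h) (by omega)).symm
  have hlt := (hB.inter hB').rk_lt (Finset.inter_subset_left.ssubset_of_ne hne)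
  have := hCf.eq_of_rk_le (Finset.subset_inter h1 h8) (by omega)
  exact hAC (this ▸ Finset.subset_inter hAB hAB')

/-- Every face above `F` is the join of the atoms above `F` that it contains. -/
lemma exists_atom_not_subset {F J K : Finset ι} (hF : Face v F) (hJ : Face v J) (hK : Face v K)
    (hFJ : F ⊆ J) (hFK : F ⊆ K) (hKJ : ¬ K ⊆ J) :
    ∃ A, Face v A ∧ F ⊆ A ∧ A ⊆ K ∧ rk v A = rk v F + 1 ∧ ¬ A ⊆ J := by
  obtain ⟨A, hA⟩ := Finset.exists_minimal
    (s := Finset.univ.filter fun A : Finset ι => Face v A ∧ F ⊆ A ∧ A ⊆ K ∧ ¬ A ⊆ J)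
    ⟨K, by simp [hK, hFK, hKJ]⟩
  have hA1 := hA.1
  simp only [Finset.mem_filter, Finset.mem_univ, true_and] at hA1
  obtain ⟨hAf, hFA, hAK, hAJ⟩ := hA1
  have hmin : ∀ B, Face v B → F ⊆ B → B ⊂ A → B ⊆ J := fun B hB h1 h2 => by
    by_contra hcon
    exact h2.2 (hA.2 (by simp [hB, h1, h2.1.trans hAK, hcon]) h2.1)
  refine ⟨A, hAf, hFA, hAK, ?_, hAJ⟩
  have hFA' : F ⊂ A := hFA.ssubset_of_ne (by rintro rfl; exact hAJ hFJ)
  have hlt := hF.rk_lt hFA'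
  by_contra hne
  -- If `A` were not an atom, it would have a corank-one face avoiding `a` and another through `a`.
  -- By minimality both lie in `J`, so both equal `A ∩ J`.
  obtain ⟨a, ha, h1, h2, h3⟩ := exists_face_rk_succ hF hAf hFA'
  have hFa : F ⊂ a := h1.ssubset_of_ne (by rintro rfl; omega)
  have haA : a ⊂ A := h2.ssubset_of_ne (by rintro rfl; omega)
  obtain ⟨C, hC, h4, h5, h6, h7⟩ := exists_coface_not_superset hF hAf hFa h2
  obtain ⟨C', hC', h8, h9, h10⟩ := exists_coface_rk_succ ha hAf haA
  have hs : ∀ X : Finset ι, X ⊆ A → rk v X + 1 = rk v A → X ⊂ A := fun X hX hr =>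
    hX.ssubset_of_ne (by rintro rfl; omega)
  have hCJ := hmin C hC h4 (hs C h5 h6)
  have hCJ' := hmin C' hC' (h1.trans h8) (hs C' h9 h10)
  have hAJ' : A ∩ J ⊂ A := Finset.inter_subset_left.ssubset_of_ne
    fun h => hAJ (Finset.inter_eq_left.1 h)
  have hr := (hAf.inter hJ).rk_lt hAJ'
  have e1 := hC.eq_of_rk_le (Finset.subset_inter h5 hCJ) (by omega)
  have e2 := hC'.eq_of_rk_le (Finset.subset_inter h9 hCJ') (by omega)
  exact h7 (e1.trans e2.symm ▸ h8)

variable (v) in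
/-- The faces of rank `j` between `F` and `T`. -/
noncomputable def facesBetween (F T : Finset ι) (j : ℕ) : Finset (Finset ι) :=
  Finset.univ.filter fun K => Face v K ∧ F ⊆ K ∧ K ⊆ T ∧ rk v K = j

@[simp] lemma mem_facesBetween {F T K : Finset ι} {j : ℕ} :
    K ∈ facesBetween v F T j ↔ Face v K ∧ F ⊆ K ∧ K ⊆ T ∧ rk v K = j := by
  simp [facesBetween]

/-- An interval of length `n` in the face lattice has at least as many elements of each rank as
a boolean lattice. -/
lemma choose_le_card_facesBetween (n : ℕ) : ∀ (j : ℕ) (F T : Finset ι), Face v F → Face v T →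
    F ⊆ T → rk v T = rk v F + n → n.choose j ≤ (facesBetween v F T (rk v F + j)).card := by
  induction n with
  | zero =>
    intro j F T hF hT h hr
    cases j with
    | zero => simpa using Finset.card_pos.2 ⟨F, by simp [hF, h]⟩
    | succ j => simp
  | succ n ih =>
    intro j F T hF hT h hr
    cases j with
    | zero => simpa using Finset.card_pos.2 ⟨F, by simp [hF, h]⟩
    | succ j =>
      have hFT : F ⊂ T := h.ssubset_of_ne (by rintro rfl; omega)
      obtain ⟨A, hA, h1, h2, h3⟩ := exists_face_rk_succ hF hT hFT
      obtain ⟨C, hC, h4, h5, h6, h7⟩ := exists_coface_not_superset hF hT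
        (h1.ssubset_of_ne (by rintro rfl; omega)) h2
      have e1 := ih j A T hA hT h2 (by omega)
      have e2 := ih (j + 1) F C hF hC h4 (by omega)
      -- Pascal's rule: the faces above the atom `A` and those below `C` are disjoint families
      -- because `A` is not contained in `C`.
      rw [Nat.choose_succ_succ]
      refine (Nat.add_le_add e1 e2).trans ?_
      rw [← Finset.card_union_of_disjoint]
      · refine Finset.card_le_card fun K hK => ?_
        rw [Finset.mem_union] at hK
        simp only [mem_facesBetween] at hK ⊢
        rcases hK with ⟨k1, k2, k3, k4⟩ | ⟨k1, k2, k3, k4⟩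
        · exact ⟨k1, h1.trans k2, k3, by omega⟩
        · exact ⟨k1, k2, k3.trans h5, by omega⟩
      · rw [Finset.disjoint_left]
        intro K hK hK'
        simp only [mem_facesBetween] at hK hK'
        exact h7 (hK.2.1.trans hK'.2.2.1)

/-! ### Atoms above a face and paths between them. -/

variable (v) in
/-- `A` is an atom of the interval of the face lattice above `F`. -/
def Atom (F A : Finset ι) : Prop := Face v A ∧ F ⊆ A ∧ rk v A = rk v F + 1

variable (v) in
/-- Two members of `D` of the same rank lie in a common face of the next rank. -/
def Step (D : Set (Finset ι)) (A B : Finset ι) : Prop :=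
  A ∈ D ∧ B ∈ D ∧ ∃ E, Face v E ∧ rk v E = rk v A + 1 ∧ rk v E = rk v B + 1 ∧ A ⊆ E ∧ B ⊆ E

variable (v) in
/-- Connectedness by a path of steps inside `D`. -/
def Linked (D : Set (Finset ι)) : Finset ι → Finset ι → Prop := Relation.ReflTransGen (Step v D)

lemma Step.symm {D : Set (Finset ι)} {A B : Finset ι} (h : Step v D A B) : Step v D B A := by
  obtain ⟨hA, hB, E, hE, h1, h2, h3, h4⟩ := h
  exact ⟨hB, hA, E, hE, h2, h1, h4, h3⟩

lemma Linked.symm {D : Set (Finset ι)} {A B : Finset ι} (h : Linked v D A B) : Linked v D B A := by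
  induction h with
  | refl => exact .refl
  | tail _ h ih => exact .head h.symm ih

lemma Linked.trans {D : Set (Finset ι)} {A B C : Finset ι} (h : Linked v D A B)
    (h' : Linked v D B C) : Linked v D A C := Relation.ReflTransGen.trans h h'

lemma Linked.mono {D D' : Set (Finset ι)} (hD : D ⊆ D') {A B : Finset ι} (h : Linked v D A B) :
    Linked v D' A B := by
  induction h with
  | refl => exact .refl
  | tail _ h ih => exact .tail ih ⟨hD h.1, hD h.2.1, h.2.2⟩

/-- A path from inside a set to its outside has a step across the boundary. -/
lemma Linked.exists_crossing {D : Set (Finset ι)} {A B : Finset ι} (h : Linked v D A B)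
    (p : Finset ι → Prop) (hA : p A) (hB : ¬ p B) :
    ∃ X Y, Step v D X Y ∧ p X ∧ ¬ p Y := by
  induction h with
  | refl => exact absurd hA hB
  | @tail b c _ hs ih =>
    by_cases hb : p b
    · exact ⟨b, c, hs, hb, hB⟩
    · exact ih hb

/-- The support of `F` shows that `v a` is not in the span of `F`; since the rank of `A` is only one
larger, `F` and `v a` together span `A`. -/
lemma Atom.apply_eq_zero {F A : Finset ι} (hF : Face v F) (hA : Atom v F A) {a : ι} (ha : a ∈ A)
    (haF : a ∉ F) {g : Dual ℝ W} (hg : ∀ i ∈ F, g (v i) = 0) (hga : g (v a) = 0) :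
    ∀ i ∈ A, g (v i) = 0 := by
  obtain ⟨f, -, hf⟩ := id hF
  have hnot : v a ∉ span ℝ (v '' (F : Set ι)) := fun h =>
    haF ((hf a).2 (span_le_ker (fun j hj => (hf j).1 hj) h))
  set p := span ℝ (v '' (F : Set ι)) ⊔ span ℝ {v a}
  have hlt : span ℝ (v '' (F : Set ι)) < p := by
    refine lt_of_le_of_ne le_sup_left fun h => hnot ?_
    rw [h]
    exact Submodule.mem_sup_right (mem_span_singleton_self _)
  have hle : p ≤ span ℝ (v '' (A : Set ι)) := by
    refine sup_le (span_mono (Set.image_mono (by exact_mod_cast hA.2.1))) ?_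
    rw [span_singleton_le_iff_mem]
    exact subset_span ⟨a, ha, rfl⟩
  have hr := hA.2.2
  have h2 := Submodule.finrank_lt_finrank_of_lt hlt
  have heq : p = span ℝ (v '' (A : Set ι)) :=
    Submodule.eq_of_le_of_finrank_le hle (by unfold rk at hr; omega)
  have hker : p ≤ LinearMap.ker g := by
    refine sup_le (span_le_ker hg) ?_
    rw [span_singleton_le_iff_mem]
    exact hga
  intro i hi
  exact hker (heq ▸ subset_span ⟨i, hi, rfl⟩)

lemma Atom.exists_mem {F A : Finset ι} (hA : Atom v F A) : ∃ a ∈ A, a ∉ F := by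
  by_contra! h
  have := hA.2.2
  rw [Finset.Subset.antisymm h hA.2.1] at this
  omega

lemma Atom.mem_of_mem {F A B : Finset ι} (hF : Face v F) (hA : Atom v F A) (hB : Face v B)
    (hFB : F ⊆ B) {a : ι} (ha : a ∈ A) (haF : a ∉ F) (haB : a ∈ B) : A ⊆ B := by
  have hss : F ⊂ A ∩ B := Finset.ssubset_iff_of_subset (Finset.subset_inter hA.2.1 hFB) |>.2
    ⟨a, by simp [ha, haB], haF⟩
  have h1 := hF.rk_lt hss
  have h2 := (hA.1.inter hB).eq_of_rk_le Finset.inter_subset_left (by have := hA.2.2; omega)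
  exact Finset.inter_eq_left.1 h2

lemma Atom.eq_of_mem {F A B : Finset ι} (hF : Face v F) (hA : Atom v F A) (hB : Atom v F B)
    {a : ι} (ha : a ∈ A) (haF : a ∉ F) (haB : a ∈ B) : A = B :=
  Finset.Subset.antisymm (hA.mem_of_mem hF hB.1 hB.2.1 ha haF haB)
    (hB.mem_of_mem hF hA.1 hA.2.1 haB haF ha)

lemma Atom.eq_of_subset {F A B : Finset ι} (hA : Atom v F A) (hB : Atom v F B) (h : A ⊆ B) :
    A = B := hA.1.eq_of_rk_le h (by rw [hA.2.2, hB.2.2])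

/-- Modulo the span of `F`, an atom is one-dimensional, so functionals vanishing on `F` are
proportional on it. This makes `slope` independent of the chosen element. -/
lemma Atom.mul_apply_eq {F A : Finset ι} (hF : Face v F) (hA : Atom v F A) {g h : Dual ℝ W}
    (hg : ∀ i ∈ F, g (v i) = 0) (hh : ∀ i ∈ F, h (v i) = 0) {a x : ι} (ha : a ∈ A) (haF : a ∉ F)
    (hx : x ∈ A) : h (v a) * g (v x) = g (v a) * h (v x) := by
  have := hA.apply_eq_zero hF ha haF (g := h (v a) • g - g (v a) • h)
    (fun i hi => by simp [hg i hi, hh i hi]) (by simp [mul_comm]) x hx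
  simpa [sub_eq_zero] using this

variable (v) in
/-- The common value of `g / h` on the elements of `A` outside `F`. -/
noncomputable def slope (F : Finset ι) (g h : Dual ℝ W) (A : Finset ι) : ℝ :=
  if H : ∃ a ∈ A, a ∉ F then g (v H.choose) / h (v H.choose) else 0

lemma Atom.slope_eq {F A : Finset ι} (hF : Face v F) (hA : Atom v F A) {g h : Dual ℝ W}
    (hg : ∀ i ∈ F, g (v i) = 0) (hh : ∀ i, i ∈ F ↔ h (v i) = 0) {a : ι} (ha : a ∈ A)
    (haF : a ∉ F) : slope v F g h A = g (v a) / h (v a) := by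
  have H : ∃ a ∈ A, a ∉ F := ⟨a, ha, haF⟩
  rw [slope, dif_pos H]
  have hb := H.choose_spec
  rw [div_eq_div_iff (fun h => hb.2 ((hh _).2 h)) (fun h => haF ((hh _).2 h))]
  have := hA.mul_apply_eq hF hg (fun i hi => (hh i).1 hi) ha haF hb.1
  linarith

/-- The improvement step of the simplex method. -/
lemma Atom.exists_improvement {F A T : Finset ι} (hF : Face v F) (hA : Atom v F A)
    (hT : Face v T) (hAT : A ⊆ T) {g h : Dual ℝ W} (hg : ∀ i ∈ F, g (v i) = 0)
    (h0 : ∀ i, 0 ≤ h (v i)) (hh : ∀ i, i ∈ F ↔ h (v i) = 0) {x : ι} (hx : x ∈ T)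
    (hxF : x ∉ F) (hlt : slope v F g h A < g (v x) / h (v x)) :
    ∃ B, Atom v F B ∧ B ⊆ T ∧ slope v F g h A < slope v F g h B ∧
      ∃ E, Face v E ∧ rk v E = rk v F + 2 ∧ A ⊆ E ∧ B ⊆ E := by
  have hpos : ∀ i ∉ F, 0 < h (v i) := fun i hi =>
    lt_of_le_of_ne (h0 i) fun h => hi ((hh i).2 h.symm)
  obtain ⟨a, ha, haF⟩ := hA.exists_mem
  have hsl := hA.slope_eq hF hg hh ha haF
  obtain ⟨f, hf, hfA⟩ := id hA.1
  have hposf : ∀ i ∉ A, 0 < f (v i) := fun i hi =>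
    lt_of_le_of_ne (hf i) fun h => hi ((hfA i).2 h.symm)
  -- This combination vanishes on `A` and, off `F`, is positive exactly where the ratio `g / h`
  -- exceeds the slope of `A`.
  set g' : Dual ℝ W := h (v a) • g - g (v a) • h with hg'
  have hg'A : ∀ i ∈ A, g' (v i) = 0 := fun i hi => by
    simpa [hg', sub_eq_zero] using hA.mul_apply_eq hF hg (fun i hi => (hh i).1 hi) ha haF hi
  have key : ∀ i ∉ F, (0 < g' (v i) ↔ slope v F g h A < g (v i) / h (v i)) := by
    intro i hi
    rw [hsl, div_lt_div_iff₀ (hpos a haF) (hpos i hi)]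
    simp only [hg', LinearMap.sub_apply, LinearMap.smul_apply, smul_eq_mul, sub_pos]
    rw [mul_comm (h (v a))]
  obtain ⟨t, ht, hface, l, hlT, hgl, hfl⟩ := hT.pivot f g' (fun i _ => hf i)
    (fun i _ hgi => hposf i fun hiS => hgi.ne' (hg'A i hiS)) ⟨x, hx, (key x hxF).2 hlt⟩
  set S := T.filter fun i => f (v i) = t * g' (v i) with hS
  have hAS : A ⊂ S := by
    refine Finset.ssubset_iff_of_subset (fun i hi => ?_) |>.2 ⟨l, ?_, fun hlS => ?_⟩
    · simp [hS, hAT hi, hg'A i hi, (hfA i).1 hi]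
    · simp [hS, hlT, hfl]
    · exact hgl.ne' (hg'A l hlS)
  -- Every point of `S` outside `A` has larger ratio, so any edge through `A` inside `S` is
  -- improving.
  obtain ⟨E, hE, h1, h2, h3⟩ := exists_face_rk_succ hA.1 hface hAS
  have hrA := hA.2.2
  obtain ⟨B, hB, h4, h5, h6, h7⟩ := exists_other_face hF hA.1 hE hA.2.1 h1 hrA (by omega)
  have hBat : Atom v F B := ⟨hB, h5, h7⟩
  obtain ⟨b, hb, hbA⟩ : ∃ b ∈ B, b ∉ A := by
    by_contra! hcon
    exact h4 (hBat.eq_of_subset hA hcon)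
  have hbF : b ∉ F := fun h => hbA (hA.2.1 h)
  have hbS := h2 (h6 hb)
  refine ⟨B, hBat, h6.trans (h2.trans (Finset.filter_subset _ _)), ?_, E, hE, by omega, h1, h6⟩
  rw [hBat.slope_eq hF hg hh hb hbF]
  refine (key b hbF).1 ?_
  have := (Finset.mem_filter.1 hbS).2
  have hfb := hposf b hbA
  rw [this] at hfb
  exact pos_of_mul_pos_right hfb ht.le

/-- Among the finitely many atoms of `T` reachable within `D`, one of largest slope cannot be
improved, so its slope is maximal over all of `T`. Only `A` and atoms of larger slope need to be in
`D`. -/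
lemma Atom.climb {F A T : Finset ι} (hF : Face v F) (hA : Atom v F A)
    (hT : Face v T) (hAT : A ⊆ T) {g h : Dual ℝ W} (hg : ∀ i ∈ F, g (v i) = 0)
    (h0 : ∀ i, 0 ≤ h (v i)) (hh : ∀ i, i ∈ F ↔ h (v i) = 0) {D : Set (Finset ι)} (hAD : A ∈ D)
    (hD : ∀ B, Atom v F B → B ⊆ T → slope v F g h A < slope v F g h B → B ∈ D) :
    ∃ B, Atom v F B ∧ B ⊆ T ∧ Linked v D A B ∧ slope v F g h A ≤ slope v F g h B ∧
      ∀ x ∈ T, x ∉ F → g (v x) / h (v x) ≤ slope v F g h B := by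
  obtain ⟨B, hB, hmax⟩ := Finset.exists_max_image
    (Finset.univ.filter fun B => Atom v F B ∧ B ⊆ T ∧ B ∈ D ∧ Linked v D A B) (slope v F g h)
    ⟨A, Finset.mem_filter.2 ⟨Finset.mem_univ _, hA, hAT, hAD, .refl⟩⟩
  simp only [Finset.mem_filter, Finset.mem_univ, true_and] at hB hmax
  have hAB := hmax A ⟨hA, hAT, hAD, .refl⟩
  refine ⟨B, hB.1, hB.2.1, hB.2.2.2, hAB, fun x hx hxF => ?_⟩
  by_contra! hcon
  obtain ⟨C, hC, h1, h2, E, hE, h3, h4, h5⟩ :=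
    hB.1.exists_improvement hF hT hB.2.1 hg h0 hh hx hxF hcon
  have hCD := hD C hC h1 (hAB.trans_lt h2)
  refine absurd (hmax C ⟨hC, h1, hCD, hB.2.2.2.trans
    (.single ⟨hB.2.2.1, hCD, E, hE, ?_, ?_, h4, h5⟩)⟩) (not_le.2 h2)
  · rw [hB.1.2.2, h3]
  · rw [hC.2.2, h3]

/-- Two atoms on the nonnegative side of a functional are linked through atoms on its positive
side. -/
lemma Atom.linked_of_nonneg {F A B T : Finset ι} (hF : Face v F) (hT : Face v T)
    (hA : Atom v F A) (hB : Atom v F B) (hAT : A ⊆ T) (hBT : B ⊆ T) {g : Dual ℝ W}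
    (hg : ∀ i ∈ F, g (v i) = 0) (hgpos : ∃ i ∈ T, 0 < g (v i)) (hgA : ∀ i ∈ A, 0 ≤ g (v i))
    (hgB : ∀ i ∈ B, 0 ≤ g (v i)) {D : Set (Finset ι)} (hAD : A ∈ D) (hBD : B ∈ D)
    (hD : ∀ C, Atom v F C → C ⊆ T → (∀ i ∈ C, i ∉ F → 0 < g (v i)) → C ∈ D) :
    Linked v D A B := by
  obtain ⟨h, h0, hh⟩ := id hF
  have hpos : ∀ i ∉ F, 0 < h (v i) := fun i hi =>
    lt_of_le_of_ne (h0 i) fun h => hi ((hh i).2 h.symm)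
  have hnn : ∀ C, Atom v F C → (∀ i ∈ C, 0 ≤ g (v i)) → 0 ≤ slope v F g h C := by
    intro C hC hgC
    obtain ⟨c, hc, hcF⟩ := hC.exists_mem
    rw [hC.slope_eq hF hg hh hc hcF]
    exact div_nonneg (hgC c hc) (h0 c)
  have hDpos : ∀ C, Atom v F C → C ⊆ T → 0 < slope v F g h C → C ∈ D := by
    intro C hC hCT hs
    refine hD C hC hCT fun i hi hiF => ?_
    rw [hC.slope_eq hF hg hh hi hiF] at hs
    exact (div_pos_iff_of_pos_right (hpos i hiF)).1 hs
  obtain ⟨A', hA', hA'T, hAA', -, hmaxA⟩ := hA.climb hF hT hAT hg h0 hh hAD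
    fun C hC hCT hs => hDpos C hC hCT ((hnn A hA hgA).trans_lt hs)
  obtain ⟨B', hB', hB'T, hBB', -, hmaxB⟩ := hB.climb hF hT hBT hg h0 hh hBD
    fun C hC hCT hs => hDpos C hC hCT ((hnn B hB hgB).trans_lt hs)
  obtain ⟨a, ha, haF⟩ := hA'.exists_mem
  obtain ⟨b, hb, hbF⟩ := hB'.exists_mem
  have hsa := hA'.slope_eq hF hg hh ha haF
  have hsb := hB'.slope_eq hF hg hh hb hbF
  have hAB : slope v F g h A' = slope v F g h B' :=
    le_antisymm (hsa ▸ hmaxB a (hA'T ha) haF) (hsb ▸ hmaxA b (hB'T hb) hbF)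
  set c := slope v F g h B' with hc
  have hcpos : 0 < c := by
    obtain ⟨i, hi, hgi⟩ := hgpos
    have hiF : i ∉ F := fun h => hgi.ne' (hg i h)
    exact (div_pos hgi (hpos i hiF)).trans_le (hmaxB i hi hiF)
  have hM := hT.relative (c • h - g) (fun i hi => by
    by_cases hiF : i ∈ F
    · simp [hg i hiF, (hh i).1 hiF]
    · have := hmaxB i hi hiF
      rw [div_le_iff₀ (hpos i hiF)] at this
      simpa using this)
  -- Both climbs end in the face `M` of `T` where `g / h` attains its maximum `c > 0`; every atom in
  -- `M` is available.
  set M := T.filter fun i => (c • h - g) (v i) = 0 with hMdef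
  have hmem : ∀ i, i ∈ M ↔ i ∈ T ∧ g (v i) = c * h (v i) := by
    intro i
    simp only [hMdef, Finset.mem_filter, LinearMap.sub_apply, LinearMap.smul_apply, smul_eq_mul,
      sub_eq_zero]
    tauto
  have hsub : ∀ C, Atom v F C → C ⊆ T → slope v F g h C = c → C ⊆ M := by
    intro C hC hCT hs i hi
    rw [hmem]
    refine ⟨hCT hi, ?_⟩
    by_cases hiF : i ∈ F
    · simp [hg i hiF, (hh i).1 hiF]
    · rw [hC.slope_eq hF hg hh hi hiF, div_eq_iff (hpos i hiF).ne'] at hs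
      exact hs
  have hMD : ∀ C, Atom v F C → C ⊆ M → C ∈ D := by
    intro C hC hCM
    refine hD C hC (hCM.trans (Finset.filter_subset _ _)) fun i hi hiF => ?_
    rw [((hmem i).1 (hCM hi)).2]
    exact mul_pos hcpos (hpos i hiF)
  have hA'M := hsub A' hA' hA'T hAB
  have hB'M := hsub B' hB' hB'T rfl
  obtain ⟨f, hf, hfB⟩ := id hB'.1
  have hfF : ∀ i ∈ F, (-f) (v i) = 0 := fun i hi => by simp [(hfB i).1 (hB'.2.1 hi)]
  -- Inside `M`, a climb for the negated support of `B'` can only stop at `B'`.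
  obtain ⟨C, hC, hCM, hA'C, -, hmaxC⟩ := hA'.climb hF hM hA'M (g := -f) hfF h0 hh
    (hMD A' hA' hA'M) fun C hC hCM _ => hMD C hC hCM
  obtain ⟨x, hx, hxF⟩ := hC.exists_mem
  have hxB : x ∈ B' := by
    have := hmaxC b (hB'M hb) hbF
    rw [hC.slope_eq hF hfF hh hx hxF] at this
    simp only [LinearMap.neg_apply, (hfB b).1 hb, neg_zero, zero_div] at this
    rw [le_div_iff₀ (hpos x hxF), zero_mul] at this
    exact (hfB x).2 (le_antisymm (by linarith) (hf x))
  rw [hC.eq_of_mem hF hB' hx hxF hxB] at hA'C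
  exact (hAA'.trans hA'C).trans hBB'.symm

/-! ### Connectivity after deleting atoms. -/

/-- Deleting the atoms in a proper face leaves the others linked. -/
lemma linked_of_not_subset_face {F G A B : Finset ι} (hF : Face v F) (hG : Face v G)
    (hFG : F ⊆ G) {D : Set (Finset ι)} (hD : ∀ C, Atom v F C → ¬ C ⊆ G → C ∈ D)
    (hA : Atom v F A) (hB : Atom v F B) (hAG : ¬ A ⊆ G) (hBD : B ∈ D) : Linked v D A B := by
  obtain ⟨f, hf, hfG⟩ := id hG
  obtain ⟨a, ha, haG⟩ := Finset.not_subset.1 hAG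
  refine hA.linked_of_nonneg hF face_univ hB (Finset.subset_univ _) (Finset.subset_univ _)
    (g := f) (fun i hi => (hfG i).1 (hFG hi))
    ⟨a, Finset.mem_univ _, lt_of_le_of_ne (hf a) fun h => haG ((hfG a).2 h.symm)⟩
    (fun i _ => hf i) (fun i _ => hf i) (hD A hA hAG) hBD fun C hC _ hpos => hD C hC fun hCG => ?_
  obtain ⟨c, hc, hcF⟩ := hC.exists_mem
  exact (hpos c hc hcF).ne' ((hfG c).1 (hCG hc))

lemma finrank_span_union_le {F : Finset ι} (X : Finset ι) :
    finrank ℝ (span ℝ (v '' ((F ∪ X : Finset ι) : Set ι))) ≤ rk v F + X.card := by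
  rw [Finset.coe_union, Set.image_union, span_union]
  refine (Submodule.finrank_add_le_finrank_add_finrank _ _).trans (Nat.add_le_add_left ?_ _)
  rw [← Finset.coe_image]
  exact (finrank_span_finset_le_card _).trans Finset.card_image_le

/-- Balinski's theorem for the atoms above a face. -/
lemma linked_of_card_lt {F A B : Finset ι} (hF : Face v F) {n : ℕ}
    (hn : rk v Finset.univ = rk v F + n + 1) {R : Finset (Finset ι)} (hR : R.card < n)
    (hA : Atom v F A) (hB : Atom v F B) (hAR : A ∉ R) (hBR : B ∉ R) :
    Linked v {C | Atom v F C ∧ C ∉ R} A B := by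
  -- There are at most `n` atoms here, so some nonzero functional vanishes on `F` and all of them.
  -- Including `A` puts `A` on the nonnegative side of both `g` and `-g`, leaving the sign free to
  -- suit `B`.
  set R' := (insert A R).filter (Atom v F) with hR'
  have hrep : ∀ C : Finset ι, ∃ c, Atom v F C → c ∈ C ∧ c ∉ F := fun C => by
    by_cases hC : Atom v F C
    · obtain ⟨c, hc⟩ := hC.exists_mem
      exact ⟨c, fun _ => hc⟩
    · obtain ⟨a, _⟩ := hA.exists_mem
      exact ⟨a, fun h => absurd h hC⟩
  choose rep hrep using hrep
  have hcard : (R'.image rep).card ≤ n := by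
    refine Finset.card_image_le.trans ((Finset.card_filter_le _ _).trans ?_)
    exact (Finset.card_insert_le _ _).trans hR
  obtain ⟨g, hgker, i, -, hgi⟩ := exists_dual_of_rk_lt (v := v) (T := Finset.univ)
    (p := span ℝ (v '' ((F ∪ R'.image rep : Finset ι) : Set ι))) (by
      have := finrank_span_union_le (v := v) (F := F) (R'.image rep)
      omega)
  have hgF : ∀ i ∈ F, g (v i) = 0 := fun i hi =>
    hgker (subset_span ⟨i, by simp [hi], rfl⟩)
  have hgR : ∀ C ∈ R', ∀ i ∈ C, g (v i) = 0 := fun C hC => by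
    have hCa : Atom v F C := (Finset.mem_filter.1 hC).2
    refine hCa.apply_eq_zero hF (hrep C hCa).1 (hrep C hCa).2 hgF ?_
    exact hgker (subset_span ⟨rep C, by
      simp only [Finset.coe_union, Set.mem_union, Finset.mem_coe]
      exact Or.inr (Finset.mem_image_of_mem _ hC), rfl⟩)
  have hgA : ∀ i ∈ A, g (v i) = 0 := hgR A (by simp [hR', hA])
  have hpos : ∀ (s : Dual ℝ W), (∀ C ∈ R', ∀ i ∈ C, s (v i) = 0) →
      ∀ C, Atom v F C → C ⊆ Finset.univ → (∀ i ∈ C, i ∉ F → 0 < s (v i)) →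
        C ∈ {C | Atom v F C ∧ C ∉ R} := by
    intro s hs C hC _ hsp
    refine ⟨hC, fun hCR => ?_⟩
    obtain ⟨c, hc, hcF⟩ := hC.exists_mem
    exact (hsp c hc hcF).ne' (hs C (by simp [hR', hCR, hC]) c hc)
  have hsign : ∀ (s : Dual ℝ W), (∀ i ∈ F, s (v i) = 0) → (∀ C ∈ R', ∀ i ∈ C, s (v i) = 0) →
      (∃ i ∈ Finset.univ, 0 < s (v i)) → (∀ i ∈ B, 0 ≤ s (v i)) →
        Linked v {C | Atom v F C ∧ C ∉ R} A B := by
    intro s hsF hsR hspos hsB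
    exact hA.linked_of_nonneg hF face_univ hB (Finset.subset_univ _) (Finset.subset_univ _) hsF
      hspos (fun i hi => (hsR A (by simp [hR', hA]) i hi).ge) hsB ⟨hA, hAR⟩ ⟨hB, hBR⟩
      (hpos s hsR)
  by_cases hneg : ∃ b ∈ B, g (v b) < 0
  · obtain ⟨b, hb, hgb⟩ := hneg
    have hbF : b ∉ F := fun h => hgb.ne (hgF b h)
    obtain ⟨h, h0, hh⟩ := id hF
    have hposh : 0 < h (v b) := lt_of_le_of_ne (h0 b) fun h => hbF ((hh b).2 h.symm)
    refine hsign (-g) (fun i hi => by simp [hgF i hi]) (fun C hC i hi => by simp [hgR C hC i hi])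
      ⟨b, Finset.mem_univ _, by simpa using hgb⟩ fun i hi => ?_
    -- On an atom `g` is proportional to the nonnegative `h`, so it does not change sign on `B`.
    have := hB.mul_apply_eq hF hgF (fun i hi => (hh i).1 hi) hb hbF hi
    have h3 : h (v b) * g (v i) ≤ 0 := by
      rw [this]; exact mul_nonpos_of_nonpos_of_nonneg hgb.le (h0 i)
    have : g (v i) ≤ 0 := by
      by_contra! hcon
      exact absurd (mul_pos hposh hcon) (not_lt.2 h3)
    simpa using this
  · push Not at hneg
    exact hsign g hgF hgR ⟨i, Finset.mem_univ _, hgi⟩ hneg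

/-- A face of rank two above `F` contains at most two atoms. -/
lemma Atom.eq_or_eq {F E A B C : Finset ι} (hF : Face v F) (hFE : rk v E = rk v F + 2)
    (hE : Face v E)
    (hA : Atom v F A) (hB : Atom v F B) (hC : Atom v F C) (hAE : A ⊆ E) (hBE : B ⊆ E)
    (hCE : C ⊆ E) (hAB : A ≠ B) : C = A ∨ C = B := by
  by_contra! hcon
  obtain ⟨a, ha, haF⟩ := hA.exists_mem
  obtain ⟨b, hb, hbF⟩ := hB.exists_mem
  obtain ⟨c, hc, hcF⟩ := hC.exists_mem
  obtain ⟨fA, h0A, hfA⟩ := id hA.1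
  obtain ⟨fB, h0B, hfB⟩ := id hB.1
  obtain ⟨fC, h0C, hfC⟩ := id hC.1
  have hbA : b ∉ A := fun h => hAB (hA.eq_of_mem hF hB h hbF hb)
  have haB : a ∉ B := fun h => hAB (hA.eq_of_mem hF hB ha haF h)
  have haC : a ∉ C := fun h => hcon.1 (hC.eq_of_mem hF hA h haF ha)
  have hbC : b ∉ C := fun h => hcon.2 (hC.eq_of_mem hF hB h hbF hb)
  have hcA : c ∉ A := fun h => hcon.1 (hC.eq_of_mem hF hA hc hcF h)
  have p1 : 0 < fB (v a) := lt_of_le_of_ne (h0B a) fun h => haB ((hfB a).2 h.symm)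
  have p2 : 0 < fA (v b) := lt_of_le_of_ne (h0A b) fun h => hbA ((hfA b).2 h.symm)
  have p3 : 0 < fC (v a) := lt_of_le_of_ne (h0C a) fun h => haC ((hfC a).2 h.symm)
  have p4 : 0 < fC (v b) := lt_of_le_of_ne (h0C b) fun h => hbC ((hfC b).2 h.symm)
  have p5 : 0 < fA (v c) := lt_of_le_of_ne (h0A c) fun h => hcA ((hfA c).2 h.symm)
  -- The coefficients make `g` vanish at `a` and `b`, hence on `E`; but `g` is negative at `c`.
  set g : Dual ℝ W := fC - (fC (v a) / fB (v a)) • fB - (fC (v b) / fA (v b)) • fA with hg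
  have hgF : ∀ i ∈ F, g (v i) = 0 := fun i hi => by
    simp [hg, (hfA i).1 (hA.2.1 hi), (hfB i).1 (hB.2.1 hi), (hfC i).1 (hC.2.1 hi)]
  have hgA := hA.apply_eq_zero hF ha haF hgF (by
    simp [hg, (hfA a).1 ha, p1.ne'])
  have hEA : Atom v A E := ⟨hE, hAE, by have := hA.2.2; omega⟩
  have hgE := hEA.apply_eq_zero hA.1 (hBE hb) hbA hgA (by
    simp [hg, (hfB b).1 hb, p2.ne'])
  have := hgE c (hCE hc)
  simp only [hg, LinearMap.sub_apply, LinearMap.smul_apply, smul_eq_mul, (hfC c).1 hc] at this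
  have q1 := mul_nonneg (div_pos p3 p1).le (h0B c)
  have q2 := mul_pos (div_pos p4 p2) p5
  linarith

/-! ### The bound and its comparison with binomial coefficients. -/

/-- The optimal connectivity bound. -/
def bound (k n : ℕ) : ℕ := if k + 2 = n then n else (k + 1) * (n - k)

lemma le_choose_add_succ (k r : ℕ) : r ≤ (k + r).choose (k + 1) := by
  induction r with
  | zero => simp
  | succ r ih =>
    rw [← add_assoc, Nat.choose_succ_succ']
    have := Nat.choose_pos (Nat.le_add_right k r)
    omega

lemma mul_le_choose (k r : ℕ) (hk : 2 ≤ k) : (k + 1) * r ≤ (k + r).choose k := by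
  induction k, hk using Nat.le_induction with
  | base =>
    rw [Nat.choose_two_right, Nat.le_div_iff_mul_le (by norm_num)]
    have : 2 + r - 1 = r + 1 := by omega
    rw [this]
    rcases r with _ | _ | r
    · simp
    · simp
    · nlinarith
  | succ k hk ih =>
    have e : k + 1 + r = k + r + 1 := by ring
    rw [e, Nat.choose_succ_succ]
    have := le_choose_add_succ k r
    nlinarith

/-- The excluded case `k = 1`, `n ≥ 4` is a true exception: there the bound is `2 * (n - 1) > n`. -/
lemma bound_le_choose {k n : ℕ} (hk : 1 ≤ k) (hn : k + 2 ≤ n) (h : 2 ≤ k ∨ k + 2 = n) :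
    bound k n ≤ n.choose k := by
  unfold bound
  split_ifs with h1
  · subst h1
    rw [Nat.choose_symm_add, Nat.choose_two_right, Nat.le_div_iff_mul_le (by norm_num)]
    have : k + 2 - 1 = k + 1 := by omega
    rw [this]
    nlinarith
  · have := mul_le_choose k (n - k) (by omega)
    rwa [Nat.add_sub_cancel' (by omega)] at this

/-! ### Counting deleted faces. -/

variable (v) in
/-- The faces of relative dimension `k` above `F` that are not in `U`. -/
def nodes (F : Finset ι) (k : ℕ) (U : Finset (Finset ι)) : Set (Finset ι) :=
  {K | Face v K ∧ F ⊆ K ∧ rk v K = rk v F + k + 1 ∧ K ∉ U}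

/-- Finitely many atoms lie in all faces above a subset of at most `i` of them, unless such a
subset spans rank `i`. -/
lemma exists_generating {F : Finset ι} (X : Finset (Finset ι)) (i : ℕ) :
    ∃ B ⊆ X, B.card ≤ i ∧
      ((∀ J, Face v J → F ⊆ J → (∀ b ∈ B, b ⊆ J) → ∀ x ∈ X, x ⊆ J) ∨
        ∀ J, Face v J → F ⊆ J → (∀ b ∈ B, b ⊆ J) → rk v F + i ≤ rk v J) := by
  induction i with
  | zero => exact ⟨∅, by simp, by simp, Or.inr fun J _ h _ => rk_mono h⟩
  | succ i ih =>
    obtain ⟨B, hBX, hBi, hB⟩ := ih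
    rcases hB with hB | hB
    · exact ⟨B, hBX, by omega, Or.inl hB⟩
    by_cases hall : ∀ J, Face v J → F ⊆ J → (∀ b ∈ B, b ⊆ J) → ∀ x ∈ X, x ⊆ J
    · exact ⟨B, hBX, by omega, Or.inl hall⟩
    push Not at hall
    obtain ⟨J, hJ, hFJ, hBJ, x, hx, hxJ⟩ := hall
    -- Greedy choice: a face `J'` containing `B` and `x` strictly contains `J ∩ J'`, which still
    -- contains `B`, so the rank bound rises by one.
    refine ⟨insert x B, Finset.insert_subset hx hBX,
      (Finset.card_insert_le _ _).trans (by omega), Or.inr fun J' hJ' hFJ' hBJ' => ?_⟩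
    have h1 := hB (J ∩ J') (hJ.inter hJ') (Finset.subset_inter hFJ hFJ') fun b hb =>
      Finset.subset_inter (hBJ b hb) (hBJ' b (Finset.mem_insert_of_mem hb))
    have h2 := (hJ.inter hJ').rk_lt (Finset.inter_subset_right.ssubset_of_ne fun h =>
      hxJ ((hBJ' x (Finset.mem_insert_self _ _)).trans (Finset.inter_eq_right.1 h)))
    omega

/-- The union bound, free of subtraction: each `b` is missed by at most `U.card - q` members of `U`.
-/
lemma card_add_mul_le (U B : Finset (Finset ι)) {q : ℕ}
    (hB : ∀ b ∈ B, q ≤ (U.filter (b ⊆ ·)).card) :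
    U.card + B.card * q ≤ (U.filter fun K => ∀ b ∈ B, b ⊆ K).card + B.card * U.card := by
  induction B using Finset.induction_on with
  | empty => simp
  | @insert b B hb ih =>
    have h1 := ih fun c hc => hB c (Finset.mem_insert_of_mem hc)
    have h2 := hB b (Finset.mem_insert_self _ _)
    rw [Finset.card_insert_of_notMem hb]
    have h3 : (U.filter fun K => ∀ c ∈ insert b B, c ⊆ K) =
        (U.filter (b ⊆ ·)) ∩ (U.filter fun K => ∀ c ∈ B, c ⊆ K) := by
      ext K
      simp only [Finset.mem_filter, Finset.mem_inter, Finset.forall_mem_insert]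
      tauto
    have h4 := Finset.card_union_add_card_inter (U.filter (b ⊆ ·))
      (U.filter fun K => ∀ c ∈ B, c ⊆ K)
    have h5 : ((U.filter (b ⊆ ·)) ∪ (U.filter fun K => ∀ c ∈ B, c ⊆ K)).card ≤ U.card :=
      Finset.card_le_card (Finset.union_subset (Finset.filter_subset _ _)
        (Finset.filter_subset _ _))
    rw [h3]
    nlinarith

lemma le_card_common (U B : Finset (Finset ι)) {q k : ℕ} (hq : q ≤ U.card)
    (hBk : B.card ≤ k + 1) (hB : ∀ b ∈ B, q ≤ (U.filter (b ⊆ ·)).card) :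
    q ≤ (U.filter fun K => ∀ b ∈ B, b ⊆ K).card + k * (U.card - q) := by
  have h := card_add_mul_le U B hB
  obtain ⟨d, hd⟩ := Nat.exists_eq_add_of_le hq
  rw [hd] at h ⊢
  rw [Nat.add_sub_cancel_left]
  nlinarith [Nat.mul_le_mul_right d hBk]

/-- If no step joins a face containing the atom `a` to one containing the adjacent atom `b`, then
many of the faces containing `a` or `b` have been deleted. -/
lemma choose_le_card_touching {F a b E : Finset ι} {n k : ℕ}
    (hn : rk v Finset.univ = rk v F + n + 1) (hk : 1 ≤ k) (hkn : k + 2 ≤ n) (ha : Atom v F a)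
    (hb : Atom v F b) (hE : Face v E) (hrE : rk v E = rk v F + 2) (haE : a ⊆ E) (hbE : b ⊆ E)
    {U : Finset (Finset ι)}
    (hsep : ∀ K K', a ⊆ K → b ⊆ K' → ¬ Step v (nodes v F k U) K K') :
    n.choose k ≤ (U.filter fun K => a ⊆ K ∨ b ⊆ K).card := by
  obtain ⟨k, rfl⟩ : ∃ l, k = l + 1 := ⟨k - 1, by omega⟩
  obtain ⟨n, rfl⟩ : ∃ l, n = l + 1 := ⟨n - 1, by omega⟩
  have hra := ha.2.2
  have hrb := hb.2.2
  have haE' : a ⊂ E := haE.ssubset_of_ne (by rintro rfl; omega)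
  have hbE' : b ⊂ E := hbE.ssubset_of_ne (by rintro rfl; omega)
  have hFE : F ⊆ E := ha.2.1.trans haE
  have c1 := choose_le_card_facesBetween n k E Finset.univ hE face_univ (Finset.subset_univ _)
    (by omega)
  have c2 := choose_le_card_facesBetween n (k + 1) E Finset.univ hE face_univ
    (Finset.subset_univ _) (by omega)
  -- A surviving face through `E` contains both `a` and `b`, so its stationary step would already
  -- join the sides.
  have h1 : ∀ K ∈ facesBetween v E Finset.univ (rk v E + k), K ∈ U := by
    intro K hK
    obtain ⟨hKf, hEK, -, hrK⟩ := mem_facesBetween.1 hK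
    by_contra hKU
    obtain ⟨H, hH, h1, -, h2⟩ := exists_face_rk_succ hKf face_univ
      ((Finset.subset_univ K).ssubset_of_ne (by rintro rfl; omega))
    have hKn : K ∈ nodes v F (k + 1) U := ⟨hKf, hFE.trans hEK, by omega, hKU⟩
    exact hsep K K (haE.trans hEK) (hbE.trans hEK) ⟨hKn, hKn, H, hH, h2, h2, h1, h1⟩
  -- In each face `H` one rank higher, a corank-one face through `a` and one through `b`, neither
  -- containing `E`, would form a step; so one of them is deleted.
  have h2 : ∀ H ∈ facesBetween v E Finset.univ (rk v E + (k + 1)), ∃ K ∈ U, Face v K ∧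
      rk v K + 1 = rk v H ∧ K ⊆ H ∧ (a ⊆ K ∨ b ⊆ K) ∧ ¬ E ⊆ K := by
    intro H hH
    obtain ⟨hHf, hEH, -, hrH⟩ := mem_facesBetween.1 hH
    obtain ⟨C, hC, c1, c2, c3, c4⟩ := exists_coface_not_superset ha.1 hHf haE' hEH
    obtain ⟨C', hC', d1, d2, d3, d4⟩ := exists_coface_not_superset hb.1 hHf hbE' hEH
    by_cases hCU : C ∈ U
    · exact ⟨C, hCU, hC, c3, c2, Or.inl c1, c4⟩
    by_cases hCU' : C' ∈ U
    · exact ⟨C', hCU', hC', d3, d2, Or.inr d1, d4⟩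
    exact absurd ⟨⟨hC, ha.2.1.trans c1, by omega, hCU⟩, ⟨hC', hb.2.1.trans d1, by omega, hCU'⟩,
      H, hHf, by omega, by omega, c2, d2⟩ (hsep C C' c1 d1)
  choose! φ hφ using h2
  -- `H` is recovered as the smallest face containing `φ H` and `E`.
  have hinj : Set.InjOn φ (facesBetween v E Finset.univ (rk v E + (k + 1)) : Set (Finset ι)) := by
    intro H hH H' hH' heq
    obtain ⟨p1, p2, p3, p4, p5, p6⟩ := hφ H hH
    obtain ⟨q1, q2, q3, q4, q5, q6⟩ := hφ H' hH'
    obtain ⟨hHf, hEH, -, hrH⟩ := mem_facesBetween.1 hH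
    obtain ⟨hHf', hEH', -, hrH'⟩ := mem_facesBetween.1 hH'
    rw [← heq] at q4
    have hlt := p2.rk_lt (Finset.ssubset_iff_subset_ne.2
      ⟨Finset.subset_inter p4 q4, fun h => p6 (h ▸ Finset.subset_inter hEH hEH')⟩)
    have e1 := (hHf.inter hHf').eq_of_rk_le Finset.inter_subset_left (by omega)
    have e2 := (hHf.inter hHf').eq_of_rk_le Finset.inter_subset_right (by omega)
    exact e1.symm.trans e2
  rw [Nat.choose_succ_succ]
  refine (Nat.add_le_add c1 c2).trans ?_
  rw [← Finset.card_image_of_injOn hinj, ← Finset.card_union_of_disjoint]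
  · refine Finset.card_le_card fun K hK => ?_
    rcases Finset.mem_union.1 hK with hK | hK
    · exact Finset.mem_filter.2 ⟨h1 K hK, Or.inl (haE.trans (mem_facesBetween.1 hK).2.1)⟩
    · obtain ⟨H, hH, rfl⟩ := Finset.mem_image.1 hK
      obtain ⟨p1, p2, p3, p4, p5, p6⟩ := hφ H hH
      exact Finset.mem_filter.2 ⟨p1, p5⟩
  · rw [Finset.disjoint_left]
    intro K hK hK'
    obtain ⟨H, hH, rfl⟩ := Finset.mem_image.1 hK'
    exact (hφ H hH).2.2.2.2.2 (mem_facesBetween.1 hK).2.1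

/-! ### The exceptional case of edges. -/

/-- The faces of rank two above `F`. -/
def IsEdge (v : ι → W) (F K : Finset ι) : Prop := Face v K ∧ F ⊆ K ∧ rk v K = rk v F + 2

lemma IsEdge.eq_of_atoms {F K K' a b : Finset ι} (hK : IsEdge v F K) (hK' : IsEdge v F K')
    (ha : Atom v F a) (hb : Atom v F b) (hab : a ≠ b) (h1 : a ⊆ K) (h2 : b ⊆ K) (h3 : a ⊆ K')
    (h4 : b ⊆ K') : K = K' := by
  have hlt : rk v a < rk v (K ∩ K') := by
    refine ha.1.rk_lt ((Finset.subset_inter h1 h3).ssubset_of_ne fun h => hab ?_)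
    exact (hb.eq_of_subset ha (h ▸ Finset.subset_inter h2 h4)).symm
  have hra := ha.2.2
  have hf := hK.1.inter hK'.1
  have e1 := hf.eq_of_rk_le Finset.inter_subset_left (by have := hK.2.2; omega)
  have e2 := hf.eq_of_rk_le Finset.inter_subset_right (by have := hK'.2.2; omega)
  exact e1.symm.trans e2

lemma IsEdge.eq_or_eq {F K a b c : Finset ι} (hF : Face v F) (hK : IsEdge v F K)
    (ha : Atom v F a) (hb : Atom v F b) (hc : Atom v F c) (hab : a ≠ b) (h1 : a ⊆ K)
    (h2 : b ⊆ K) (h3 : c ⊆ K) : c = a ∨ c = b :=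
  ha.eq_or_eq hF hK.2.2 hK.1 hb hc h1 h2 h3 hab

/-- An atom lies in at least `n` edges; those outside `Z` lead to distinct members of `Y`. -/
lemma le_card_add_card_erase {F c : Finset ι} {n : ℕ} (hn : rk v Finset.univ = rk v F + n + 1)
    (hc : Atom v F c) (Y Z : Finset (Finset ι))
    (hY : ∀ K d, IsEdge v F K → c ⊆ K → Atom v F d → d ≠ c → d ⊆ K → K ∈ Z ∨ d ∈ Y)
    (hF : Face v F) : n ≤ Z.card + (Y.erase c).card := by
  have hrc := hc.2.2
  have h1 := choose_le_card_facesBetween n 1 c Finset.univ hc.1 face_univ (Finset.subset_univ _)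
    (by omega)
  rw [Nat.choose_one_right] at h1
  have h2 : ∀ K ∈ facesBetween v c Finset.univ (rk v c + 1) \ Z, ∃ d ∈ Y.erase c,
      Atom v F d ∧ d ⊆ K := by
    intro K hK
    obtain ⟨hK, hKZ⟩ := Finset.mem_sdiff.1 hK
    obtain ⟨hKf, hcK, -, hr⟩ := mem_facesBetween.1 hK
    obtain ⟨d, hd, hdc, hFd, hdK, hrd⟩ := exists_other_face hF hc.1 hKf hc.2.1 hcK hrc (by omega)
    have hda : Atom v F d := ⟨hd, hFd, hrd⟩
    refine ⟨d, Finset.mem_erase.2 ⟨hdc, ?_⟩, hda, hdK⟩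
    exact (hY K d ⟨hKf, hc.2.1.trans hcK, by omega⟩ hcK hda hdc hdK).resolve_left hKZ
  choose! φ hφ using h2
  have h3 : (facesBetween v c Finset.univ (rk v c + 1) \ Z).card ≤ (Y.erase c).card := by
    refine Finset.card_le_card_of_injOn φ (fun K hK => (hφ K hK).1) ?_
    intro K hK K' hK' heq
    obtain ⟨p1, p2, p3⟩ := hφ K hK
    obtain ⟨q1, q2, q3⟩ := hφ K' hK'
    obtain ⟨hKf, hcK, -, hr⟩ := mem_facesBetween.1 (Finset.mem_sdiff.1 hK).1
    obtain ⟨hKf', hcK', -, hr'⟩ := mem_facesBetween.1 (Finset.mem_sdiff.1 hK').1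
    have e1 : IsEdge v F K := ⟨hKf, hc.2.1.trans hcK, by omega⟩
    have e2 : IsEdge v F K' := ⟨hKf', hc.2.1.trans hcK', by omega⟩
    exact e1.eq_of_atoms e2 hc p2 (Finset.mem_erase.1 p1).1.symm hcK p3 hcK' (heq ▸ q3)
  have h4 := Finset.card_le_card_sdiff_add_card (t := Z)
    (s := facesBetween v c Finset.univ (rk v c + 1))
  omega

/-- The counting argument for `1`-dimensional faces: a partition of the atoms with few deleted
edges into two nonempty parts such that every edge between the parts has been deleted, with many
deleted edges near each of them, is impossible. -/
lemma edge_partition_false {F : Finset ι} (hF : Face v F) {n : ℕ}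
    (hn : rk v Finset.univ = rk v F + n + 1) (hn4 : 4 ≤ n) {U : Finset (Finset ι)}
    (hU : ∀ K ∈ U, IsEdge v F K) (hcard : U.card + 3 ≤ 2 * n) (p : Finset ι → Prop)
    (hp : ∀ a b E, Atom v F a → Atom v F b → (U.filter (a ⊆ ·)).card < n - 1 →
      (U.filter (b ⊆ ·)).card < n - 1 → p a → ¬ p b → IsEdge v F E → a ⊆ E → b ⊆ E →
      E ∈ U ∧ n ≤ (U.filter fun K => a ⊆ K ∨ b ⊆ K).card)
    {a₀ b₀ : Finset ι} (ha₀ : Atom v F a₀) (hb₀ : Atom v F b₀)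
    (hga₀ : (U.filter (a₀ ⊆ ·)).card < n - 1) (hgb₀ : (U.filter (b₀ ⊆ ·)).card < n - 1)
    (hpa₀ : p a₀) (hpb₀ : ¬ p b₀) : False := by
  set X : Finset (Finset ι) := Finset.univ.filter fun x =>
    Atom v F x ∧ n - 1 ≤ (U.filter (x ⊆ ·)).card with hX
  have hmX : ∀ x, x ∈ X ↔ Atom v F x ∧ n - 1 ≤ (U.filter (x ⊆ ·)).card := by simp [hX]
  have hinter : ∀ x y, Atom v F x → Atom v F y → x ≠ y →
      (U.filter (x ⊆ ·) ∩ U.filter (y ⊆ ·)).card ≤ 1 := by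
    intro x y hx hy hxy
    rw [Finset.card_le_one]
    intro K hK K' hK'
    simp only [Finset.mem_inter, Finset.mem_filter] at hK hK'
    exact (hU K hK.1.1).eq_of_atoms (hU K' hK'.1.1) hx hy hxy hK.1.2 hK.2.2 hK'.1.2 hK'.2.2
  -- Two bad atoms share at most one edge, so they account for at least `2 * (n - 1) - 1 ≥ U.card`
  -- deleted edges. A third one could then meet at most two, fewer than `n - 1`.
  have htwo : ∀ x ∈ X, ∀ y ∈ X, x ≠ y → U.filter (x ⊆ ·) ∪ U.filter (y ⊆ ·) = U := by
    intro x hx y hy hxy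
    rw [hmX] at hx hy
    have h1 := hinter x y hx.1 hy.1 hxy
    have h2 := Finset.card_union_add_card_inter (U.filter (x ⊆ ·)) (U.filter (y ⊆ ·))
    exact Finset.eq_of_subset_of_card_le (Finset.union_subset (Finset.filter_subset _ _)
      (Finset.filter_subset _ _)) (by omega)
  have hX2 : X.card ≤ 2 := by
    by_contra! hcon
    obtain ⟨x, hx, y, hy, z, hz, hxy, hxz, hyz⟩ := Finset.two_lt_card.1 hcon
    have h1 := htwo x hx y hy hxy
    have h2 := hinter z x ((hmX z).1 hz).1 ((hmX x).1 hx).1 hxz.symm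
    have h3 := hinter z y ((hmX z).1 hz).1 ((hmX y).1 hy).1 hyz.symm
    have h4 : U.filter (z ⊆ ·) = (U.filter (z ⊆ ·) ∩ U.filter (x ⊆ ·)) ∪
        (U.filter (z ⊆ ·) ∩ U.filter (y ⊆ ·)) := by
      rw [← Finset.inter_union_distrib_left, h1]
      exact (Finset.inter_eq_left.2 (Finset.filter_subset _ _)).symm
    have h5 := Finset.card_union_le (U.filter (z ⊆ ·) ∩ U.filter (x ⊆ ·))
        (U.filter (z ⊆ ·) ∩ U.filter (y ⊆ ·))
    rw [← h4] at h5
    have h6 := ((hmX z).1 hz).2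
    omega
  have hgood : ∀ x, Atom v F x → x ∉ X → (U.filter (x ⊆ ·)).card < n - 1 := by
    intro x hx hxX
    by_contra! hcon
    exact hxX ((hmX x).2 ⟨hx, hcon⟩)
  have hnX : ∀ x, (U.filter (x ⊆ ·)).card < n - 1 → x ∉ X := fun x h hx =>
    absurd ((hmX x).1 hx).2 (not_le.2 h)
  have hstep : ∀ (D : Set (Finset ι)) x y, Step v D x y → Atom v F x → Atom v F y →
      ∃ E, IsEdge v F E ∧ x ⊆ E ∧ y ⊆ E := by
    rintro D x y ⟨-, -, E, hE, h1, -, h2, h3⟩ hx hy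
    have := hx.2.2
    exact ⟨E, ⟨hE, hx.2.1.trans h2, by omega⟩, h2, h3⟩
  -- a deleted edge between the two parts
  obtain ⟨a, b, hs, hpa, hpb⟩ := (linked_of_card_lt hF hn (R := X) (by omega) ha₀ hb₀
    (hnX _ hga₀) (hnX _ hgb₀)).exists_crossing p hpa₀ hpb₀
  obtain ⟨⟨ha, haX⟩, ⟨hb, hbX⟩, -⟩ := id hs
  obtain ⟨E, hE, haE, hbE⟩ := hstep _ a b hs ha hb
  have hga := hgood a ha haX
  have hgb := hgood b hb hbX
  have hab : a ≠ b := fun h => hpb (h ▸ hpa)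
  obtain ⟨hEU, hT⟩ := hp a b E ha hb hga hgb hpa hpb hE haE hbE
  set U' := U.filter fun K => ¬ (a ⊆ K ∨ b ⊆ K) with hU'
  have hU'card : U'.card + 3 ≤ n := by
    have : (U.filter fun K => a ⊆ K ∨ b ⊆ K).card + U'.card = U.card := by
      rw [hU']
      convert Finset.card_filter_add_card_filter_not (s := U) (fun K => a ⊆ K ∨ b ⊆ K)
    omega
  -- Two bad atoms would cover `U`, but the deleted edge `E` contains only the good atoms `a` and
  -- `b`.
  have hX1 : X.card ≤ 1 := by
    rw [Finset.card_le_one]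
    intro x hx y hy
    by_contra hxy
    have hne : ∀ z ∈ X, z ⊆ E → False := by
      intro z hz hzE
      rcases hE.eq_or_eq hF ha hb ((hmX z).1 hz).1 hab haE hbE hzE with rfl | rfl
      · exact haX hz
      · exact hbX hz
    have := htwo x hx y hy hxy ▸ hEU
    rcases Finset.mem_union.1 this with h | h
    · exact hne x hx (Finset.mem_filter.1 h).2
    · exact hne y hy (Finset.mem_filter.1 h).2
  -- At most two of the `n - 1` deleted edges at `x` meet `a` or `b`; the others exhaust `U'`, which
  -- has at most `n - 3` members.
  have hXU' : ∀ x ∈ X, ∀ K ∈ U', x ⊆ K := by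
    intro x hx
    have hxa : x ≠ a := fun h => haX (h ▸ hx)
    have hxb : x ≠ b := fun h => hbX (h ▸ hx)
    have h1 := hinter x a ((hmX x).1 hx).1 ha hxa
    have h2 := hinter x b ((hmX x).1 hx).1 hb hxb
    have h3 : U.filter (x ⊆ ·) ⊆ (U'.filter (x ⊆ ·)) ∪
        ((U.filter (x ⊆ ·) ∩ U.filter (a ⊆ ·)) ∪ (U.filter (x ⊆ ·) ∩ U.filter (b ⊆ ·))) := by
      intro K hK
      simp only [hU', Finset.mem_union, Finset.mem_inter, Finset.mem_filter] at hK ⊢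
      tauto
    have h4 := (Finset.card_le_card h3).trans (Finset.card_union_le _ _)
    have h5 := Finset.card_union_le (U.filter (x ⊆ ·) ∩ U.filter (a ⊆ ·))
      (U.filter (x ⊆ ·) ∩ U.filter (b ⊆ ·))
    have h6 := ((hmX x).1 hx).2
    have h7 := Finset.eq_of_subset_of_card_le (Finset.filter_subset (x ⊆ ·) U') (by omega)
    intro K hK
    rw [← h7] at hK
    exact (Finset.mem_filter.1 hK).2
  set A : Finset (Finset ι) := Finset.univ.filter fun c => Atom v F c ∧ c ∉ X ∧ p c with hA
  set B : Finset (Finset ι) := Finset.univ.filter fun c => Atom v F c ∧ c ∉ X ∧ ¬ p c with hB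
  have hmA : ∀ c, c ∈ A ↔ Atom v F c ∧ c ∉ X ∧ p c := by simp [hA]
  have hmB : ∀ c, c ∈ B ↔ Atom v F c ∧ c ∉ X ∧ ¬ p c := by simp [hB]
  have haA : a ∈ A := (hmA a).2 ⟨ha, haX, hpa⟩
  have hbB : b ∈ B := (hmB b).2 ⟨hb, hbX, hpb⟩
  have hABU : ∀ c ∈ A, ∀ d ∈ B, ∀ K, IsEdge v F K → c ⊆ K → d ⊆ K → K ∈ U := by
    intro c hc d hd K hK h1 h2
    rw [hmA] at hc
    rw [hmB] at hd
    exact (hp c d K hc.1 hd.1 (hgood c hc.1 hc.2.1) (hgood d hd.1 hd.2.1) hc.2.2 hd.2.2 hK h1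
      h2).1
  have hAB : ∀ c ∈ A, ∀ d ∈ B, c ≠ d := by
    rintro c hc d hd rfl
    exact ((hmB c).1 hd).2.2 ((hmA c).1 hc).2.2
  have hcases : ∀ d, Atom v F d → d ∈ A ∨ d ∈ B ∨ d ∈ X := by
    intro d hd
    rw [hmA, hmB]
    tauto
  have hcut : ∀ K ∈ U, ∀ c ∈ A, ∀ d ∈ B, c ⊆ K → d ⊆ K → ∀ x, Atom v F x → x ⊆ K →
      x = c ∨ x = d := by
    intro K hK c hc d hd h1 h2 x hx hxK
    exact (hU K hK).eq_or_eq hF ((hmA c).1 hc).1 ((hmB d).1 hd).1 hx (hAB c hc d hd) h1 h2 hxK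
  -- neither part is a single atom
  have hcardA : 2 ≤ A.card := by
    by_contra! hlt
    have hAa : A = {a} := by
      have : A.card ≤ 1 := by omega
      rw [Finset.card_le_one] at this
      exact Finset.eq_singleton_iff_unique_mem.2 ⟨haA, fun c hc => this c hc a haA⟩
    have := le_card_add_card_erase hn ha X (U.filter (a ⊆ ·)) (fun K d hK h1 hd hda h2 => by
      rcases hcases d hd with h | h | h
      · rw [hAa, Finset.mem_singleton] at h
        exact absurd h hda
      · exact Or.inl (Finset.mem_filter.2 ⟨hABU a haA d h K hK h1 h2, h1⟩)
      · exact Or.inr h) hF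
    have := Finset.card_erase_le (s := X) (a := a)
    omega
  have hcardB : B ≠ {b} := by
    intro hBb
    have := le_card_add_card_erase hn hb X (U.filter (b ⊆ ·)) (fun K d hK h1 hd hda h2 => by
      rcases hcases d hd with h | h | h
      · exact Or.inl (Finset.mem_filter.2 ⟨hABU d h b hbB K hK h2 h1, h1⟩)
      · rw [hBb, Finset.mem_singleton] at h
        exact absurd h hda
      · exact Or.inr h) hF
    have := Finset.card_erase_le (s := X) (a := b)
    omega
  -- a small set of atoms meeting all edges between the parts
  set U'' := U'.filter fun K => ∃ c ∈ A, c ⊆ K ∧ ∃ d ∈ B, d ⊆ K with hU''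
  have hend : ∀ K ∈ U'', ∃ c ∈ A, c ⊆ K ∧ ∃ d ∈ B, d ⊆ K := fun K hK =>
    (Finset.mem_filter.1 hK).2
  choose! e he using hend
  -- `R` meets every edge between `A` and `B`: those not touching `a` or `b` are in `U''` and are
  -- met at the endpoint that `e` picks in `A`. Having fewer than `n` members, `R` must swallow one
  -- side.
  set R : Finset (Finset ι) := insert a (insert b (X ∪ U''.image e)) with hR
  have hXU'' : X.Nonempty → U'' = ∅ := by
    rintro ⟨x, hx⟩
    rw [Finset.eq_empty_iff_forall_notMem]
    intro K hK
    obtain ⟨c, hc, hcK, d, hd, hdK⟩ := (Finset.mem_filter.1 hK).2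
    have hKU' := (Finset.mem_filter.1 hK).1
    have hKU := (Finset.mem_filter.1 hKU').1
    rcases hcut K hKU c hc d hd hcK hdK x ((hmX x).1 hx).1 (hXU' x hx K hKU') with rfl | rfl
    · exact ((hmA x).1 hc).2.1 hx
    · exact ((hmB x).1 hd).2.1 hx
  have hU''card : X.card + U''.card + 3 ≤ n := by
    rcases X.eq_empty_or_nonempty with h | h
    · rw [h]
      have : U''.card ≤ U'.card := Finset.card_filter_le _ _
      simp only [Finset.card_empty]
      omega
    · rw [hXU'' h]
      simp only [Finset.card_empty]
      omega
  have hRcard : R.card < n := by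
    have h1 : R.card ≤ (insert b (X ∪ U''.image e)).card + 1 := Finset.card_insert_le _ _
    have h2 := Finset.card_insert_le b (X ∪ U''.image e)
    have h3 := Finset.card_union_le X (U''.image e)
    have h4 := Finset.card_image_le (s := U'') (f := e)
    omega
  have hsplit : A ⊆ R ∨ B ⊆ R := by
    by_contra! hcon
    obtain ⟨c, hc, hcR⟩ := Finset.not_subset.1 hcon.1
    obtain ⟨d, hd, hdR⟩ := Finset.not_subset.1 hcon.2
    obtain ⟨x, y, hs, hpx, hpy⟩ := (linked_of_card_lt hF hn hRcard ((hmA c).1 hc).1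
      ((hmB d).1 hd).1 hcR hdR).exists_crossing p ((hmA c).1 hc).2.2 ((hmB d).1 hd).2.2
    obtain ⟨⟨hx, hxR⟩, ⟨hy, hyR⟩, -⟩ := id hs
    obtain ⟨K, hK, hxK, hyK⟩ := hstep _ x y hs hx hy
    simp only [hR, Finset.mem_insert, Finset.mem_union, not_or] at hxR hyR
    have hxA := (hmA x).2 ⟨hx, hxR.2.2.1, hpx⟩
    have hyB := (hmB y).2 ⟨hy, hyR.2.2.1, hpy⟩
    have hKU := hABU x hxA y hyB K hK hxK hyK
    have hKa := hcut K hKU x hxA y hyB hxK hyK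
    have hKU'' : K ∈ U'' := by
      simp only [hU'', hU', Finset.mem_filter]
      refine ⟨⟨hKU, ?_⟩, x, hxA, hxK, y, hyB, hyK⟩
      rintro (h | h)
      · rcases hKa a ha h with h | h
        · exact hxR.1 h.symm
        · exact hyR.1 h.symm
      · rcases hKa b hb h with h | h
        · exact hxR.2.1 h.symm
        · exact hyR.2.1 h.symm
    obtain ⟨h1, h2, -⟩ := he K hKU''
    rcases hKa (e K) ((hmA _).1 h1).1 h2 with h | h
    · exact hxR.2.2.2 (h ▸ Finset.mem_image_of_mem e hKU'')
    · exact hpy (h ▸ ((hmA _).1 h1).2.2)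
  rcases hsplit with hsub | hsub
  · have hAR : A ⊆ insert a (U''.image e) := by
      intro c hc
      have := hsub hc
      simp only [hR, Finset.mem_insert, Finset.mem_union] at this ⊢
      rcases this with h | h | h | h
      · exact Or.inl h
      · exact absurd h (hAB c hc b hbB)
      · exact absurd h ((hmA c).1 hc).2.1
      · exact Or.inr h
    have h1 := (Finset.card_le_card hAR).trans (Finset.card_insert_le _ _)
    have h2 := Finset.card_image_le (s := U'') (f := e)
    have hX0 : X = ∅ := by
      by_contra hne
      have hq : U''.card = 0 := by rw [hXU'' (Finset.nonempty_iff_ne_empty.2 hne)]; rfl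
      omega
    set Z : Finset ι → Finset (Finset ι) := fun c =>
      U.filter fun K => c ⊆ K ∧ ∃ d ∈ B, d ⊆ K with hZ
    -- Of the at least `n` edges at `c`, at most `A.card - 1` stay in `A`; with `X` empty the others
    -- cross to `B` and are deleted.
    have hdeg : ∀ c ∈ A, n + 1 - A.card ≤ (Z c).card := by
      intro c hc
      have := le_card_add_card_erase hn ((hmA c).1 hc).1 A (Z c) (fun K d hK h1 hd hdc h2 => by
        rcases hcases d hd with h | h | h
        · exact Or.inr h
        · exact Or.inl (Finset.mem_filter.2 ⟨hABU c hc d h K hK h1 h2, h1, d, h, h2⟩)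
        · simp [hX0] at h) hF
      rw [Finset.card_erase_of_mem hc] at this
      omega
    have hdisj : (A : Set (Finset ι)).PairwiseDisjoint Z := by
      intro c hc c' hc' hne
      rw [Function.onFun, Finset.disjoint_left]
      intro K hK hK'
      obtain ⟨hKU, hcK, d, hd, hdK⟩ := Finset.mem_filter.1 hK
      obtain ⟨-, hcK', -⟩ := Finset.mem_filter.1 hK'
      rcases hcut K hKU c hc d hd hcK hdK c' ((hmA c').1 hc').1 hcK' with h | h
      · exact hne h.symm
      · exact hAB c' hc' d hd h
    have hsum : A.card * (n + 1 - A.card) ≤ U.card := by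
      rw [← smul_eq_mul]
      refine (Finset.card_nsmul_le_sum A _ _ hdeg).trans ?_
      rw [← Finset.card_biUnion hdisj]
      exact Finset.card_le_card (Finset.biUnion_subset.2 fun c _ => Finset.filter_subset _ _)
    -- Since `2 ≤ A.card ≤ n - 2`, the product is at least `2 * (n - 1)`, more than `U.card`.
    obtain ⟨s, hs⟩ : ∃ s, A.card = s + 2 := ⟨A.card - 2, by omega⟩
    obtain ⟨r, rfl⟩ : ∃ r, n = s + r + 3 := ⟨n - s - 3, by omega⟩
    have e1 : s + r + 3 + 1 - A.card = r + 2 := by omega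
    rw [e1, hs] at hsum
    nlinarith
  · refine hcardB (Finset.eq_singleton_iff_unique_mem.2 ⟨hbB, fun d hd => ?_⟩)
    have := hsub hd
    simp only [hR, Finset.mem_insert, Finset.mem_union] at this
    rcases this with h | h | h | h
    · exact absurd h.symm (hAB a haA d hd)
    · exact h
    · exact absurd h ((hmB d).1 hd).2.1
    · obtain ⟨K, hK, rfl⟩ := Finset.mem_image.1 h
      exact absurd rfl (hAB _ (he K hK).1 _ hd)

/-! ### The induction on `k`. -/

lemma nodes_filter_subset {F a : Finset ι} {k : ℕ} {U : Finset (Finset ι)} (ha : Atom v F a) :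
    nodes v a k (U.filter (a ⊆ ·)) ⊆ nodes v F (k + 1) U := by
  rintro K ⟨hK, h1, h2, h3⟩
  have := ha.2.2
  exact ⟨hK, ha.2.1.trans h1, by omega, fun h => h3 (Finset.mem_filter.2 ⟨h, h1⟩)⟩

/-- A face that has not been deleted contains an atom that is contained in few deleted faces. -/
lemma exists_atom_card_lt {F K : Finset ι} {k q : ℕ} (hF : Face v F) {U : Finset (Finset ι)}
    (hU : ∀ K ∈ U, Face v K ∧ F ⊆ K ∧ rk v K = rk v F + k + 1)
    (hq : k * (U.card - q) < q) (hK : K ∈ nodes v F k U) :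
    ∃ a, Atom v F a ∧ a ⊆ K ∧ (U.filter (a ⊆ ·)).card < q := by
  by_contra! hcon
  obtain ⟨hKf, hFK, hrK, hKU⟩ := hK
  -- At most `k + 1` atoms generate `K`. If all atoms of `K` were bad, at least `q - k * (U.card -
  -- q) > 0` deleted faces would contain these, and such a face equals `K`.
  obtain ⟨B, hBX, hBk, hB⟩ := exists_generating (v := v) (F := F)
    (Finset.univ.filter fun a => Atom v F a ∧ a ⊆ K) (k + 1)
  have hBm : ∀ b ∈ B, Atom v F b ∧ b ⊆ K := fun b hb => by simpa using hBX hb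
  have hKF : ¬ K ⊆ F := fun h => by
    have := rk_mono (v := v) h
    omega
  obtain ⟨a, ha, h1, h2, h3, -⟩ := exists_atom_not_subset hF hF hKf subset_rfl hFK hKF
  have hqU := (hcon a ⟨ha, h1, h3⟩ h2).trans (Finset.card_filter_le _ _)
  have hc := le_card_common U B hqU hBk fun b hb => hcon b (hBm b hb).1 (hBm b hb).2
  obtain ⟨J, hJ⟩ : (U.filter fun K => ∀ b ∈ B, b ⊆ K).Nonempty := by
    rw [← Finset.card_pos]
    omega
  obtain ⟨hJU, hBJ⟩ := Finset.mem_filter.1 hJ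
  obtain ⟨hJf, hFJ, hrJ⟩ := hU J hJU
  have hKJ : K ⊆ J := by
    rcases hB with hB | hB
    · by_contra hn
      obtain ⟨c, hc, c1, c2, c3, c4⟩ := exists_atom_not_subset hF hJf hKf hFJ hFK hn
      exact c4 (hB J hJf hFJ hBJ c (Finset.mem_filter.2 ⟨Finset.mem_univ _, ⟨hc, c1, c3⟩, c2⟩))
    · have := hB (K ∩ J) (hKf.inter hJf) (Finset.subset_inter hFK hFJ) fun b hb =>
        Finset.subset_inter (hBm b hb).2 (hBJ b hb)
      exact Finset.inter_eq_left.1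
        ((hKf.inter hJf).eq_of_rk_le Finset.inter_subset_left (by omega))
  exact hKU (hKf.eq_of_rk_le hKJ (by omega) ▸ hJU)

/-- The atoms that are contained in many deleted faces all lie in a common smaller face. -/
lemma exists_face_of_card_le {F : Finset ι} {k q : ℕ} (hF : Face v F) {U : Finset (Finset ι)}
    (hU : ∀ K ∈ U, Face v K ∧ F ⊆ K ∧ rk v K = rk v F + k + 1)
    (hq : k * (U.card - q) + 1 < q) :
    ∃ G, Face v G ∧ F ⊆ G ∧ rk v G < rk v F + k + 1 ∧
      ∀ a, Atom v F a → q ≤ (U.filter (a ⊆ ·)).card → a ⊆ G := by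
  by_cases hex : ∃ a, Atom v F a ∧ q ≤ (U.filter (a ⊆ ·)).card
  swap
  · exact ⟨F, hF, subset_rfl, by omega, fun a h1 h2 => absurd ⟨a, h1, h2⟩ hex⟩
  obtain ⟨a, -, ha⟩ := hex
  obtain ⟨B, hBX, hBk, hB⟩ := exists_generating (v := v) (F := F)
    (Finset.univ.filter fun a => Atom v F a ∧ q ≤ (U.filter (a ⊆ ·)).card) (k + 1)
  have hBm : ∀ b ∈ B, Atom v F b ∧ q ≤ (U.filter (b ⊆ ·)).card := fun b hb => by
    simpa using hBX hb
  have hc := le_card_common U B (ha.trans (Finset.card_filter_le _ _)) hBk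
    fun b hb => (hBm b hb).2
  -- Two distinct deleted faces contain the generating atoms; their intersection is the required
  -- `G`.
  obtain ⟨J, hJ, J', hJ', hne⟩ := Finset.one_lt_card.1
    (show 1 < (U.filter fun K => ∀ b ∈ B, b ⊆ K).card by omega)
  obtain ⟨hJU, hBJ⟩ := Finset.mem_filter.1 hJ
  obtain ⟨hJU', hBJ'⟩ := Finset.mem_filter.1 hJ'
  obtain ⟨hJf, hFJ, hrJ⟩ := hU J hJU
  obtain ⟨hJf', hFJ', hrJ'⟩ := hU J' hJU'
  have hf := hJf.inter hJf'
  have hlt : rk v (J ∩ J') < rk v F + (k + 1) := by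
    by_contra hge
    have e1 := hf.eq_of_rk_le Finset.inter_subset_left (by omega)
    have e2 := hf.eq_of_rk_le Finset.inter_subset_right (by omega)
    exact hne (e1.symm.trans e2)
  have hsub := Finset.subset_inter hFJ hFJ'
  have hBs : ∀ b ∈ B, b ⊆ J ∩ J' := fun b hb => Finset.subset_inter (hBJ b hb) (hBJ' b hb)
  rcases hB with hB | hB
  · exact ⟨J ∩ J', hf, hsub, hlt, fun x hx hqx => hB _ hf hsub hBs x (by simp [hx, hqx])⟩
  · exact absurd (hB _ hf hsub hBs) (not_le.2 hlt)

/-- The faces of relative dimension `k` above `F` stay linked when fewer than `bound k n` of them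
are deleted. -/
theorem linked_nodes (k : ℕ) : ∀ (n : ℕ) (F : Finset ι), Face v F →
    rk v Finset.univ = rk v F + n + 1 → k < n → ∀ U : Finset (Finset ι),
    (∀ K ∈ U, Face v K ∧ F ⊆ K ∧ rk v K = rk v F + k + 1) → U.card < bound k n →
    ∀ K₀ ∈ nodes v F k U, ∀ K₁ ∈ nodes v F k U, Linked v (nodes v F k U) K₀ K₁ := by
  induction k with
  | zero =>
    rintro n F hF hn hkn U hU hcard K₀ ⟨h1, h2, h3, h4⟩ K₁ ⟨g1, g2, g3, g4⟩
    have hlt : U.card < n := by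
      unfold bound at hcard
      split_ifs at hcard <;> omega
    refine (linked_of_card_lt hF hn hlt ⟨h1, h2, h3⟩ ⟨g1, g2, g3⟩ h4 g4).mono ?_
    rintro C ⟨⟨c1, c2, c3⟩, c4⟩
    exact ⟨c1, c2, c3, c4⟩
  | succ j ih =>
    intro n F hF hn hkn U hU hcard K₀ hK₀ K₁ hK₁
    by_cases hkn' : n = j + 2
    · have r0 := hK₀.2.2.1
      have r1 := hK₁.2.2.1
      exact .single ⟨hK₀, hK₁, Finset.univ, face_univ, by omega, by omega,
        Finset.subset_univ _, Finset.subset_univ _⟩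
    by_contra hnot
    set q := bound j (n - 1) with hq
    have hstar : ∀ a, Atom v F a → (U.filter (a ⊆ ·)).card < q → ∀ K ∈ nodes v F (j + 1) U,
        ∀ K' ∈ nodes v F (j + 1) U, a ⊆ K → a ⊆ K' → Linked v (nodes v F (j + 1) U) K K' := by
      rintro a ha hga K ⟨h1, h2, h3, h4⟩ K' ⟨g1, g2, g3, g4⟩ haK haK'
      have hra := ha.2.2
      refine (ih (n - 1) a ha.1 (by omega) (by omega) (U.filter (a ⊆ ·)) (fun L hL => ?_) hga
        K ⟨h1, haK, by omega, fun h => h4 (Finset.mem_filter.1 h).1⟩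
        K' ⟨g1, haK', by omega, fun h => g4 (Finset.mem_filter.1 h).1⟩).mono
          (nodes_filter_subset ha)
      obtain ⟨hLU, haL⟩ := Finset.mem_filter.1 hL
      obtain ⟨l1, l2, l3⟩ := hU L hLU
      exact ⟨l1, haL, by omega⟩
    -- The two shapes of the bound. In the generic one, with `k = j + 1`, `bound k n` exceeds `q` by
    -- `n - k`, so `U.card - q ≤ n - k - 1`.
    have hqv : (j + 3 = n → q = j + 2 ∧ U.card ≤ q) ∧
        (j + 3 ≠ n → (j + 1) * (U.card - q) + j + 1 ≤ q) := by
      constructor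
      · intro h
        have e1 : q = j + 2 := by rw [hq, bound, if_pos (by omega)]; omega
        rw [bound, if_pos (by omega)] at hcard
        exact ⟨e1, by omega⟩
      · intro h
        have e1 : q = (j + 1) * (n - 1 - j) := by rw [hq, bound, if_neg (by omega)]
        rw [bound, if_neg (by omega)] at hcard
        obtain ⟨r, rfl⟩ : ∃ r, n = j + 1 + (r + 1) := ⟨n - j - 2, by omega⟩
        have e2 : j + 1 + (r + 1) - 1 - j = r + 1 := by omega
        have e3 : j + 1 + (r + 1) - (j + 1) = r + 1 := by omega
        rw [e2] at e1
        rw [e3] at hcard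
        have h3 : U.card - q ≤ r := by
          rw [e1, Nat.sub_le_iff_le_add]
          nlinarith
        nlinarith [Nat.mul_le_mul_left (j + 1) h3]
    have hq1 : (j + 1) * (U.card - q) < q := by
      by_cases h : j + 3 = n
      · obtain ⟨h1, h2⟩ := hqv.1 h
        rw [Nat.sub_eq_zero_of_le h2]
        omega
      · have := hqv.2 h
        omega
    -- a pair of adjacent atoms on the two sides
    set p : Finset ι → Prop := fun a => ∃ K ∈ nodes v F (j + 1) U, a ⊆ K ∧
      Linked v (nodes v F (j + 1) U) K₀ K with hp
    obtain ⟨a₀, ha₀, ha₀K, hga₀⟩ := exists_atom_card_lt hF hU hq1 hK₀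
    obtain ⟨a₁, ha₁, ha₁K, hga₁⟩ := exists_atom_card_lt hF hU hq1 hK₁
    have hpa₀ : p a₀ := ⟨K₀, hK₀, ha₀K, .refl⟩
    have hpa₁ : ¬ p a₁ := by
      rintro ⟨K, hK, haK, hl⟩
      exact hnot (hl.trans (hstar a₁ ha₁ hga₁ K hK K₁ hK₁ haK ha₁K))
    have hsep : ∀ a b, Atom v F a → (U.filter (a ⊆ ·)).card < q → p a → ¬ p b →
        ∀ K K', a ⊆ K → b ⊆ K' → ¬ Step v (nodes v F (j + 1) U) K K' := by
      rintro a b ha hga ⟨K₂, hK₂, haK₂, hl⟩ hpb K K' haK hbK' hs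
      exact hpb ⟨K', hs.2.1, hbK',
        (hl.trans (hstar a ha hga K₂ hK₂ K hs.1 haK₂ haK)).tail hs⟩
    have htouch : ∀ a b E, Atom v F a → Atom v F b → (U.filter (a ⊆ ·)).card < q → p a → ¬ p b →
        Face v E → rk v E = rk v F + 2 → a ⊆ E → b ⊆ E →
        n.choose (j + 1) ≤ (U.filter fun K => a ⊆ K ∨ b ⊆ K).card :=
      fun a b E ha hb hga hpa hpb hE hrE haE hbE =>
        choose_le_card_touching hn (by omega) (by omega) ha hb hE hrE haE hbE
          (hsep a b ha hga hpa hpb)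
    by_cases hmain : 2 ≤ j + 1 ∨ j + 3 = n
    · have hq2 : (j + 1) * (U.card - q) + 1 < q := by
        by_cases h : j + 3 = n
        · obtain ⟨h1, h2⟩ := hqv.1 h
          rw [Nat.sub_eq_zero_of_le h2]
          omega
        · have := hqv.2 h
          omega
      obtain ⟨G, hG, hFG, hrG, hGa⟩ := exists_face_of_card_le hF hU hq2
      set D : Set (Finset ι) := {C | Atom v F C ∧ (U.filter (C ⊆ ·)).card < q} with hD
      have hDG : ∀ C, Atom v F C → ¬ C ⊆ G → C ∈ D := fun C hC hCG =>
        ⟨hC, by by_contra! hcon; exact hCG (hGa C hC hcon)⟩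
      -- An atom outside `G` serves as a hub to which both `a₀` and `a₁` are linked through good
      -- atoms.
      obtain ⟨c, hc, c1, c2, c3, c4⟩ := exists_atom_not_subset hF hG face_univ hFG
        (Finset.subset_univ _) (fun h => by
          have := rk_mono (v := v) h
          omega)
      have hca : Atom v F c := ⟨hc, c1, c3⟩
      have hl : Linked v D a₀ a₁ :=
        (linked_of_not_subset_face hF hG hFG hDG hca ha₀ c4 ⟨ha₀, hga₀⟩).symm.trans
          (linked_of_not_subset_face hF hG hFG hDG hca ha₁ c4 ⟨ha₁, hga₁⟩)
      obtain ⟨a, b, ⟨⟨ha, hga⟩, ⟨hb, -⟩, E, hE, h1, -, h2, h3⟩, hpa, hpb⟩ :=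
        hl.exists_crossing p hpa₀ hpa₁
      have hra := ha.2.2
      have e1 := htouch a b E ha hb hga hpa hpb hE (by omega) h2 h3
      have e2 := bound_le_choose (k := j + 1) (n := n) (by omega) (by omega) hmain
      have e3 := e1.trans (Finset.card_filter_le _ _)
      omega
    · obtain rfl : j = 0 := by omega
      have hq' : q = n - 1 := by rw [hq, bound, if_neg (by omega)]; omega
      rw [bound, if_neg (by omega)] at hcard
      refine edge_partition_false hF hn (by omega) (U := U) (fun K hK => ?_) (by omega) p ?_
        ha₀ ha₁ (hq' ▸ hga₀) (hq' ▸ hga₁) hpa₀ hpa₁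
      · obtain ⟨h1, h2, h3⟩ := hU K hK
        exact ⟨h1, h2, by omega⟩
      · intro a b E ha hb hga hgb hpa hpb hE haE hbE
        have := htouch a b E ha hb (hq' ▸ hga) hpa hpb hE.1 hE.2.2 haE hbE
        rw [zero_add, Nat.choose_one_right] at this
        refine ⟨?_, this⟩
        by_contra hEU
        have hrE := hE.2.2
        have hEn : E ∈ nodes v F (0 + 1) U := ⟨hE.1, hE.2.1, by omega, hEU⟩
        obtain ⟨H, hH, h1, -, h2⟩ := exists_face_rk_succ hE.1 face_univ
          ((Finset.subset_univ E).ssubset_of_ne (by rintro rfl; omega))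
        exact hsep a b ha (hq' ▸ hga) hpa hpb E E haE hbE ⟨hEn, hEn, H, hH, h2, h2, h1, h1⟩

end Faces

/-! ### From polytopes to vector configurations. -/

section Polytopes

variable {E : Type*} [NormedAddCommGroup E] [NormedSpace ℝ E] [FiniteDimensional ℝ E]
  {ι : Type*} [Fintype ι]

/-- The homogenization of a point configuration. -/
def homogenize (p : ι → E) (i : ι) : E × ℝ := (p i, 1)

/-- The indices of the points lying in `F`. -/
noncomputable def indices (p : ι → E) (F : Set E) : Finset ι := Finset.univ.filter fun i => p i ∈ F

variable {p : ι → E}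

@[simp] lemma mem_indices {F : Set E} {i : ι} : i ∈ indices p F ↔ p i ∈ F := by simp [indices]

lemma dual_apply_sum (f : Dual ℝ (E × ℝ)) {κ : Type*} [Fintype κ] {w : κ → ℝ} {z : κ → E}
    (hw : ∑ i, w i = 1) : f (∑ i, w i • z i, 1) = ∑ i, w i * f (z i, 1) := by
  have : ((∑ i, w i • z i, 1) : E × ℝ) = ∑ i, w i • ((z i, 1) : E × ℝ) := by
    ext
    · simp [Prod.fst_sum]
    · simp [Prod.snd_sum, hw]
  rw [this, map_sum]
  exact Finset.sum_congr rfl fun i _ => by rw [map_smul, smul_eq_mul]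

lemma dual_nonneg_of_mem_convexHull {f : Dual ℝ (E × ℝ)} (hf : ∀ i, 0 ≤ f (homogenize p i))
    {x : E} (hx : x ∈ convexHull ℝ (Set.range p)) : 0 ≤ f (x, 1) := by
  obtain ⟨κ, _, w, z, hw, hw1, hz, rfl⟩ := mem_convexHull_iff_exists_fintype.1 hx
  rw [dual_apply_sum f hw1]
  refine Finset.sum_nonneg fun i _ => mul_nonneg (hw i) ?_
  obtain ⟨j, hj⟩ := hz i
  rw [← hj]
  exact hf j

/-- The zero set of a supporting functional is spanned by the points of the configuration that it
contains. -/
lemma mem_convexHull_image_iff {f : Dual ℝ (E × ℝ)} (hf : ∀ i, 0 ≤ f (homogenize p i))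
    {S : Finset ι} (hS : ∀ i, i ∈ S ↔ f (homogenize p i) = 0) {x : E} :
    x ∈ convexHull ℝ (p '' S) ↔ x ∈ convexHull ℝ (Set.range p) ∧ f (x, 1) = 0 := by
  constructor
  · intro hx
    refine ⟨convexHull_mono (Set.image_subset_range _ _) hx, ?_⟩
    obtain ⟨κ, _, w, z, hw, hw1, hz, rfl⟩ := mem_convexHull_iff_exists_fintype.1 hx
    rw [dual_apply_sum f hw1]
    refine Finset.sum_eq_zero fun i _ => ?_
    obtain ⟨j, hj, hji⟩ := hz i
    have := (hS j).1 hj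
    rw [homogenize, hji] at this
    rw [this, mul_zero]
  · rintro ⟨hx, hfx⟩
    obtain ⟨κ, _, w, z, hw, hw1, hz, rfl⟩ := mem_convexHull_iff_exists_fintype.1 hx
    rw [dual_apply_sum f hw1] at hfx
    have hnn : ∀ i, 0 ≤ f (z i, 1) := fun i => by
      obtain ⟨j, hj⟩ := hz i
      rw [← hj]
      exact hf j
    have h0 := (Finset.sum_eq_zero_iff_of_nonneg fun i _ => mul_nonneg (hw i) (hnn i)).1 hfx
    have e1 : ∑ i, w i • z i = ∑ i ∈ Finset.univ.filter (fun i => w i ≠ 0), w i • z i := by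
      rw [Finset.sum_filter]
      exact Finset.sum_congr rfl fun i _ => by split_ifs with h <;> simp_all
    have e2 : ∑ i ∈ Finset.univ.filter (fun i => w i ≠ 0), w i = 1 := by
      rw [Finset.sum_filter_ne_zero, hw1]
    rw [e1]
    refine (convex_convexHull ℝ _).sum_mem (fun i _ => hw i) e2 fun i hi => ?_
    obtain ⟨j, hj⟩ := hz i
    refine subset_convexHull ℝ _ ⟨j, ?_, hj⟩
    have := (mul_eq_zero.1 (h0 i (Finset.mem_univ _))).resolve_left (Finset.mem_filter.1 hi).2
    rw [← hj] at this
    exact (hS j).2 this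

/-- The gap `l x₀ - l x` to the maximum is affine in `x`, hence linear on `E × ℝ`; it is nonnegative
on the polytope and vanishes exactly on `F`. -/
lemma face_indices_of_isExposed {F : Set E} (hF : IsExposed ℝ (convexHull ℝ (Set.range p)) F)
    (hne : F.Nonempty) : Face (homogenize p) (indices p F) ∧
      F = convexHull ℝ (p '' (indices p F : Set ι)) := by
  obtain ⟨l, hl⟩ := hF hne
  obtain ⟨x₀, hx₀⟩ := hne
  rw [hl] at hx₀
  set f : Dual ℝ (E × ℝ) :=
    l x₀ • LinearMap.snd ℝ E ℝ - (l : E →ₗ[ℝ] ℝ).comp (LinearMap.fst ℝ E ℝ) with hf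
  have hfx : ∀ x, f (x, 1) = l x₀ - l x := fun x => by simp [hf]
  have hmem : ∀ x, x ∈ F ↔ x ∈ convexHull ℝ (Set.range p) ∧ f (x, 1) = 0 := by
    intro x
    rw [hl, hfx, sub_eq_zero]
    constructor
    · rintro ⟨h1, h2⟩
      exact ⟨h1, le_antisymm (h2 _ hx₀.1) (hx₀.2 _ h1)⟩
    · rintro ⟨h1, h2⟩
      exact ⟨h1, fun y hy => h2 ▸ hx₀.2 y hy⟩
  have hpi : ∀ i, p i ∈ convexHull ℝ (Set.range p) := fun i => subset_convexHull ℝ _ ⟨i, rfl⟩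
  have h0 : ∀ i, 0 ≤ f (homogenize p i) := fun i => by
    rw [homogenize, hfx, sub_nonneg]
    exact hx₀.2 _ (hpi i)
  have hS : ∀ i, i ∈ indices p F ↔ f (homogenize p i) = 0 := fun i => by
    rw [mem_indices, hmem, homogenize]
    exact and_iff_right (hpi i)
  exact ⟨⟨f, h0, hS⟩, Set.ext fun x => by rw [hmem, mem_convexHull_image_iff h0 hS]⟩

lemma isExposed_of_face {S : Finset ι} (hS : Face (homogenize p) S) :
    IsExposed ℝ (convexHull ℝ (Set.range p)) (convexHull ℝ (p '' S)) := by
  obtain ⟨f, hf, hfS⟩ := hS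
  rintro ⟨x₀, hx₀⟩
  refine ⟨-(LinearMap.toContinuousLinearMap (f.comp (LinearMap.inl ℝ E ℝ))), Set.ext fun x => ?_⟩
  have hfx : ∀ x, f (x, 1) = f (x, 0) + f (0, 1) := fun x => by rw [← map_add]; simp
  rw [mem_convexHull_image_iff hf hfS] at hx₀ ⊢
  have e0 := hfx x₀
  have e1 := hfx x
  simp only [Set.mem_ofPred_eq, _root_.neg_apply, neg_le_neg_iff,
    LinearMap.coe_toContinuousLinearMap', LinearMap.comp_apply, LinearMap.inl_apply]
  refine and_congr_right fun hx => ⟨fun h y hy => ?_, fun h => ?_⟩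
  · have := dual_nonneg_of_mem_convexHull hf hy
    have := hfx y
    linarith
  · have := dual_nonneg_of_mem_convexHull hf hx
    have := h x₀ hx₀.1
    linarith

lemma indices_convexHull {S : Finset ι} (hS : Face (homogenize p) S) :
    indices p (convexHull ℝ (p '' S)) = S := by
  obtain ⟨f, hf, hfS⟩ := hS
  ext i
  rw [mem_indices, mem_convexHull_image_iff hf hfS, hfS, homogenize]
  exact and_iff_right (subset_convexHull ℝ _ ⟨i, rfl⟩)

/-- The rank of a homogenized point configuration exceeds its affine dimension by one. -/
lemma rk_homogenize {S : Finset ι} (hS : S.Nonempty) :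
    rk (homogenize p) S = finrank ℝ (affineSpan ℝ (convexHull ℝ (p '' S))).direction + 1 := by
  obtain ⟨i₀, hi₀⟩ := hS
  rw [affineSpan_convexHull, direction_affineSpan,
    vectorSpan_eq_span_vsub_set_right ℝ (Set.mem_image_of_mem p hi₀)]
  set V := span ℝ ((fun x => x -ᵥ p i₀) '' (p '' (S : Set ι))) with hV
  have hmap : finrank ℝ (V.map (LinearMap.inl ℝ E ℝ)) = finrank ℝ V :=
    (Submodule.equivMapOfInjective _ LinearMap.inl_injective V).finrank_eq.symm
  -- The span splits into the direction space at height zero and one vector at height one.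
  have hsup : span ℝ (homogenize p '' (S : Set ι)) =
      V.map (LinearMap.inl ℝ E ℝ) ⊔ span ℝ {homogenize p i₀} := by
    apply le_antisymm
    · rw [span_le]
      rintro _ ⟨i, hi, rfl⟩
      have : homogenize p i = LinearMap.inl ℝ E ℝ (p i -ᵥ p i₀) + homogenize p i₀ := by
        ext <;> simp [homogenize]
      rw [this]
      exact Submodule.add_mem_sup (mem_map_of_mem (subset_span ⟨p i, ⟨i, hi, rfl⟩, rfl⟩))
        (mem_span_singleton_self _)
    · refine sup_le ?_ ?_
      · rw [hV, map_span, span_le]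
        rintro _ ⟨_, ⟨_, ⟨i, hi, rfl⟩, rfl⟩, rfl⟩
        have : LinearMap.inl ℝ E ℝ (p i -ᵥ p i₀) = homogenize p i - homogenize p i₀ := by
          ext <;> simp [homogenize]
        simp only [this, SetLike.mem_coe]
        exact sub_mem (subset_span ⟨i, hi, rfl⟩) (subset_span ⟨i₀, hi₀, rfl⟩)
      · rw [span_singleton_le_iff_mem]
        exact subset_span ⟨i₀, hi₀, rfl⟩
  have hne : homogenize p i₀ ≠ 0 := fun h => by simpa [homogenize] using congrArg Prod.snd h
  have hinf : V.map (LinearMap.inl ℝ E ℝ) ⊓ span ℝ {homogenize p i₀} = ⊥ := by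
    rw [eq_bot_iff]
    rintro x ⟨⟨y, -, hy⟩, hx⟩
    obtain ⟨c, rfl⟩ := mem_span_singleton.1 hx
    have hc := congrArg Prod.snd hy
    simp only [LinearMap.inl_apply, homogenize, Prod.smul_mk, smul_eq_mul, mul_one] at hc
    simp [← hc]
  have := Submodule.finrank_sup_add_finrank_inf_eq (V.map (LinearMap.inl ℝ E ℝ))
    (span ℝ {homogenize p i₀})
  rw [hinf, finrank_bot, add_zero, finrank_span_singleton hne, hmap] at this
  rw [rk, hsup, this]

lemma face_empty : Face (homogenize p) ∅ :=
  ⟨LinearMap.snd ℝ E ℝ, by simp [homogenize], by simp [homogenize]⟩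

lemma rk_empty : rk (homogenize p) ∅ = 0 := by
  rw [rk, Finset.coe_empty, Set.image_empty, span_empty, finrank_bot]

lemma nonempty_of_rk_pos {S : Finset ι} {k : ℕ} (h : rk (homogenize p) S = k + 1) :
    S.Nonempty := by
  rw [Finset.nonempty_iff_ne_empty]
  rintro rfl
  simp [rk_empty] at h

lemma isFaceOfDim_of_face {S : Finset ι} {k : ℕ} (hS : Face (homogenize p) S)
    (hr : rk (homogenize p) S = k + 1) :
    IsFaceOfDim (convexHull ℝ (Set.range p)) k (convexHull ℝ (p '' S)) := by
  have hne := nonempty_of_rk_pos hr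
  refine ⟨isExposed_of_face hS, ?_, ?_⟩
  · rw [convexHull_nonempty_iff]
    exact hne.to_set.image p
  · have := rk_homogenize (p := p) hne
    omega

lemma IsFaceOfDim.face {F : Set E} {k : ℕ}
    (hF : IsFaceOfDim (convexHull ℝ (Set.range p)) k F) :
    Face (homogenize p) (indices p F) ∧ rk (homogenize p) (indices p F) = k + 1 ∧
      convexHull ℝ (p '' (indices p F : Set ι)) = F := by
  obtain ⟨h1, h2, h3⟩ := hF
  obtain ⟨g1, g2⟩ := face_indices_of_isExposed h1 h2
  have hne : (indices p F).Nonempty := by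
    rw [g2, convexHull_nonempty_iff] at h2
    simpa using h2
  exact ⟨g1, by rw [rk_homogenize hne, ← g2, h3], g2.symm⟩

/-- The `k`-dimensional faces of a polytope as faces of rank `k + 1` of its homogenized
configuration. -/
noncomputable def faceEquiv (p : ι → E) (k : ℕ) :
    {F : Set E // IsFaceOfDim (convexHull ℝ (Set.range p)) k F} ≃
      {S : Finset ι // Face (homogenize p) S ∧ rk (homogenize p) S = k + 1} where
  toFun F := ⟨indices p F.1, (IsFaceOfDim.face F.2).1, (IsFaceOfDim.face F.2).2.1⟩
  invFun S := ⟨convexHull ℝ (p '' S.1), isFaceOfDim_of_face S.2.1 S.2.2⟩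
  left_inv F := Subtype.ext (IsFaceOfDim.face F.2).2.2
  right_inv S := Subtype.ext (indices_convexHull S.2.1)

lemma faceGraph_adj_iff {k : ℕ}
    {F G : {F : Set E // IsFaceOfDim (convexHull ℝ (Set.range p)) k F}} :
    (faceGraph (convexHull ℝ (Set.range p)) k).Adj F G ↔ F ≠ G ∧ ∃ H, Face (homogenize p) H ∧
      rk (homogenize p) H = k + 2 ∧ indices p F.1 ⊆ H ∧ indices p G.1 ⊆ H := by
  refine and_congr_right fun _ => ⟨?_, ?_⟩
  · rintro ⟨H, hH, h1, h2⟩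
    refine ⟨indices p H, (IsFaceOfDim.face hH).1, (IsFaceOfDim.face hH).2.1, ?_, ?_⟩
    · exact fun i hi => mem_indices.2 (h1 (mem_indices.1 hi))
    · exact fun i hi => mem_indices.2 (h2 (mem_indices.1 hi))
  · rintro ⟨H, hH, hr, h1, h2⟩
    refine ⟨convexHull ℝ (p '' H), isFaceOfDim_of_face hH hr, ?_, ?_⟩
    · rw [← (IsFaceOfDim.face F.2).2.2]
      exact convexHull_mono (Set.image_mono (by exact_mod_cast h1))
    · rw [← (IsFaceOfDim.face G.2).2.2]
      exact convexHull_mono (Set.image_mono (by exact_mod_cast h2))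

lemma rk_univ_homogenize {d : ℕ} (h : HasDim (convexHull ℝ (Set.range p)) d) :
    rk (homogenize p) Finset.univ = d + 1 := by
  have hne : (Finset.univ : Finset ι).Nonempty := by
    have := h.1
    rw [convexHull_nonempty_iff] at this
    obtain ⟨_, i, _⟩ := this
    exact ⟨i, Finset.mem_univ i⟩
  rw [rk_homogenize hne, Finset.coe_univ, Set.image_univ, h.2]

/-- Supplies the `m + 1` nodes demanded by connectivity, as a `d`-polytope has at least as many
`k`-faces as a simplex. -/
lemma bound_lt_choose {k d : ℕ} (h : k < d) : bound k d < (d + 1).choose (k + 1) := by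
  have key : ∀ a r : ℕ, a * r + 1 ≤ (a + r).choose a := by
    intro a r
    induction a with
    | zero => simp
    | succ a ih =>
      have e : a + 1 + r = a + r + 1 := by ring
      rw [e, Nat.choose_succ_succ']
      have := le_choose_add_succ a r
      nlinarith
  have h1 := key (k + 1) (d - k)
  have e : k + 1 + (d - k) = d + 1 := by omega
  rw [e] at h1
  unfold bound
  split_ifs with h2
  · have : d - k = 2 := by omega
    rw [this] at h1
    omega
  · omega

lemma bound_pos {k d : ℕ} (h : k < d) : 0 < bound k d := by
  unfold bound
  split_ifs
  · omega
  · exact Nat.mul_pos (Nat.succ_pos k) (by omega)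

lemma isVertexConnected_faceGraph_range {k d : ℕ} (hd : HasDim (convexHull ℝ (Set.range p)) d)
    (hkd : k < d) :
    IsVertexConnected (faceGraph (convexHull ℝ (Set.range p)) k) (bound k d) := by
  have hr := rk_univ_homogenize hd
  set e := faceEquiv p k with he
  have hcard : bound k d + 1 ≤
      Fintype.card {S : Finset ι // Face (homogenize p) S ∧ rk (homogenize p) S = k + 1} := by
    have h1 := choose_le_card_facesBetween (d + 1) (k + 1) ∅ Finset.univ (face_empty (p := p))
      face_univ (Finset.subset_univ _) (by rw [rk_empty, hr, zero_add])
    rw [Fintype.card_subtype]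
    refine (Nat.succ_le_of_lt (bound_lt_choose hkd)).trans (h1.trans (Finset.card_le_card ?_))
    intro K hK
    obtain ⟨g1, -, -, g2⟩ := mem_facesBetween.1 hK
    rw [rk_empty, zero_add] at g2
    exact Finset.mem_filter.2 ⟨Finset.mem_univ _, g1, g2⟩
  have : Fintype {F : Set E // IsFaceOfDim (convexHull ℝ (Set.range p)) k F} :=
    Fintype.ofEquiv _ e.symm
  rw [← Fintype.card_congr e] at hcard
  refine ⟨by rw [ENat.card_eq_coe_fintype_card]; exact_mod_cast hcard, fun S hS => ?_⟩
  have hbpos := bound_pos hkd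
  rw [SimpleGraph.connected_iff]
  constructor
  · set U : Finset (Finset ι) := S.image fun F => indices p F.1 with hU
    have hmem : ∀ F : {F : Set E // IsFaceOfDim (convexHull ℝ (Set.range p)) k F},
        indices p F.1 ∈ U ↔ F ∈ S := by
      intro F
      rw [hU, Finset.mem_image]
      constructor
      · rintro ⟨G, hG, hGF⟩
        have : e G = e F := Subtype.ext hGF
        exact e.injective this ▸ hG
      · exact fun h => ⟨F, h, rfl⟩
    have hnode : ∀ F : {F : Set E // IsFaceOfDim (convexHull ℝ (Set.range p)) k F}, F ∉ S →
        indices p F.1 ∈ nodes (homogenize p) ∅ k U := by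
      intro F hF
      obtain ⟨h1, h2, -⟩ := IsFaceOfDim.face F.2
      exact ⟨h1, Finset.empty_subset _, by rw [rk_empty, h2, zero_add],
        fun h => hF ((hmem F).1 h)⟩
    rintro ⟨F, hF⟩ ⟨G, hG⟩
    have hFS : F ∉ S := by simpa using hF
    have hGS : G ∉ S := by simpa using hG
    have hl := linked_nodes k d ∅ (face_empty (p := p)) (by rw [hr, rk_empty, zero_add]) hkd U
      (fun K hK => by
        obtain ⟨H, -, rfl⟩ := Finset.mem_image.1 hK
        obtain ⟨h1, h2, -⟩ := IsFaceOfDim.face H.2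
        exact ⟨h1, Finset.empty_subset _, by rw [rk_empty, h2, zero_add]⟩)
      (lt_of_le_of_lt Finset.card_image_le (by omega)) _ (hnode F hFS) _ (hnode G hGS)
    have key : ∀ K, Linked (homogenize p) (nodes (homogenize p) ∅ k U) (indices p F.1) K →
        ∀ H : {F : Set E // IsFaceOfDim (convexHull ℝ (Set.range p)) k F},
          ∀ hH : H ∈ ((S : Set _)ᶜ), indices p H.1 = K →
            ((faceGraph (convexHull ℝ (Set.range p)) k).induce ((S : Set _)ᶜ)).Reachable
              ⟨F, hF⟩ ⟨H, hH⟩ := by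
      intro K hK
      induction hK with
      | refl =>
        intro H hH hHF
        have : e H = e F := Subtype.ext hHF
        obtain rfl := e.injective this
        rfl
      | @tail L M _ hs ih =>
        intro H hH hHM
        obtain ⟨⟨l1, -, l2, l3⟩, -, D, hD, d1, -, d3, d4⟩ := hs
        rw [rk_empty, zero_add] at l2
        set H' := e.symm ⟨L, l1, l2⟩ with hH'
        have hH'L : indices p H'.1 = L := congrArg Subtype.val (e.apply_symm_apply ⟨L, l1, l2⟩)
        have hH'S : H' ∈ ((S : Set _)ᶜ) := by
          intro h
          exact l3 (hH'L ▸ (hmem H').2 (by simpa using h))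
        refine (ih H' hH'S hH'L).trans ?_
        -- A step may be stationary, unlike an edge of the graph.
        by_cases heq : H' = H
        · subst heq
          rfl
        · refine SimpleGraph.Adj.reachable ?_
          rw [SimpleGraph.induce_adj, faceGraph_adj_iff]
          exact ⟨heq, D, hD, by omega, hH'L ▸ d3, hHM ▸ d4⟩
    exact key _ hl G hG rfl
  · obtain ⟨F, hF⟩ : ∃ F, F ∉ S := by
      by_contra! hall
      have := Finset.card_le_card (fun F _ => hall F :
        (Finset.univ : Finset {F : Set E // IsFaceOfDim (convexHull ℝ (Set.range p)) k F}) ⊆ S)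
      rw [Finset.card_univ] at this
      omega
    exact ⟨F, by simpa using hF⟩

/-- The graph of `k`-dimensional faces of a `d`-dimensional polytope is
`bound k d`-connected. -/
theorem isVertexConnected_faceGraph {P : Set E} (hP : IsPolytope P) {k d : ℕ} (hd : HasDim P d)
    (hkd : k < d) : IsVertexConnected (faceGraph P k) (bound k d) := by
  obtain ⟨s, hs, rfl⟩ := hP
  have := hs.fintype
  have hrange : Set.range (Subtype.val : s → E) = s := Subtype.range_coe
  rw [← hrange] at hd ⊢
  exact isVertexConnected_faceGraph_range hd hkd

end Polytopes

/-! ### Simplices and bipyramids: optimality. -/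

section UpperBounds

/-- Deleting a separating set of nodes bounds the connectivity of a graph. -/
lemma le_card_of_separates {V α : Type*} {G : SimpleGraph V} {m : ℕ}
    (hG : IsVertexConnected G m) {φ : V → α} (hφ : Function.Injective φ) (N : Finset α)
    (p : V → Prop) {x y : V} (hx : φ x ∉ N) (hy : φ y ∉ N) (hpx : p x) (hpy : ¬ p y)
    (h : ∀ a b, G.Adj a b → φ a ∉ N → φ b ∉ N → p a → p b) : m ≤ N.card := by
  by_contra! hlt
  set S : Finset V := N.preimage φ hφ.injOn
  have hS : S.card ≤ N.card :=
    Finset.card_le_card_of_injOn φ (fun a ha => Finset.mem_preimage.1 ha) hφ.injOn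
  have hmem : ∀ a, a ∈ ((S : Set V)ᶜ) ↔ φ a ∉ N := fun a => by simp [S]
  have hr := (hG.2 S (by omega)).preconnected ⟨x, (hmem x).2 hx⟩ ⟨y, (hmem y).2 hy⟩
  rw [SimpleGraph.reachable_iff_reflTransGen] at hr
  have key : ∀ z, Relation.ReflTransGen (G.induce ((S : Set V)ᶜ)).Adj ⟨x, (hmem x).2 hx⟩ z →
      p z.1 := by
    intro z hz
    induction hz with
    | refl => exact hpx
    | @tail a b _ hab ih => exact h a.1 b.1 hab ((hmem _).1 a.2) ((hmem _).1 b.2) ih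
  exact hpy (key _ hr)

/-- The degree of a node bounds the connectivity of a graph. -/
lemma le_card_of_neighbors {V α : Type*} {G : SimpleGraph V} {m : ℕ}
    (hG : IsVertexConnected G m) {φ : V → α} (hφ : Function.Injective φ) (N : Finset α)
    {x : V} (hx : φ x ∉ N) (h : ∀ y, G.Adj x y → φ y ∈ N) : m ≤ N.card := by
  by_cases hy : ∃ y, φ y ∉ N ∧ y ≠ x
  · obtain ⟨y, hy, hyx⟩ := hy
    refine le_card_of_separates hG hφ N (· = x) hx hy rfl hyx ?_
    rintro _ b hab - hb rfl
    exact absurd (h b hab) hb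
  · push Not at hy
    -- If nothing remains besides `x`, the required number of nodes gives the inequality.
    have hmem : ∀ y, φ y ∈ insert (φ x) N := fun y => by
      by_cases hyN : φ y ∈ N
      · exact Finset.mem_insert_of_mem hyN
      · rw [hy y hyN]; exact Finset.mem_insert_self _ _
    have h1 := ENat.card_le_card_of_injective (f := fun y => (⟨φ y, hmem y⟩ : ↥(insert (φ x) N)))
      fun a b hab => hφ (congrArg Subtype.val hab)
    rw [ENat.card_eq_coe_fintype_card (α := ↥(insert (φ x) N)), Fintype.card_coe,
      Finset.card_insert_of_notMem hx] at h1
    have h2 : m + 1 ≤ N.card + 1 := by exact_mod_cast hG.1.trans h1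
    omega

lemma rk_eq_card {W ι : Type*} [AddCommGroup W] [Module ℝ W] {v : ι → W}
    (hv : LinearIndependent ℝ v) (S : Finset ι) : rk v S = S.card := by
  have := finrank_span_eq_card (hv.comp (Subtype.val : S → ι) Subtype.val_injective)
  rw [Fintype.card_coe] at this
  rw [rk, Set.image_eq_range, ← this]
  rfl

lemma hasDim_of_rk {E : Type*} [NormedAddCommGroup E] [NormedSpace ℝ E] [FiniteDimensional ℝ E]
    {ι : Type*} [Fintype ι] {p : ι → E} {d : ℕ} (h : rk (homogenize p) Finset.univ = d + 1) :
    HasDim (convexHull ℝ (Set.range p)) d := by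
  have hne := nonempty_of_rk_pos h
  have h1 := rk_homogenize (p := p) hne
  rw [Finset.coe_univ, Set.image_univ] at h1
  refine ⟨?_, by omega⟩
  rw [convexHull_nonempty_iff]
  obtain ⟨i, -⟩ := hne
  exact ⟨p i, i, rfl⟩

lemma indices_injective {E : Type*} [NormedAddCommGroup E] [NormedSpace ℝ E]
    [FiniteDimensional ℝ E] {ι : Type*} [Fintype ι] {p : ι → E} {k : ℕ} :
    Function.Injective fun F : {F : Set E // IsFaceOfDim (convexHull ℝ (Set.range p)) k F} =>
      indices p F.1 :=
  fun _ _ h => (faceEquiv p k).injective (Subtype.ext h)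

/-- The vertices of a simplex. -/
noncomputable def simplexPoint (d : ℕ) : Option (Fin d) → EuclideanSpace ℝ (Fin d)
  | none => 0
  | some i => EuclideanSpace.single i 1

lemma linearIndependent_simplexPoint (d : ℕ) :
    LinearIndependent ℝ (homogenize (simplexPoint d)) := by
  rw [Fintype.linearIndependent_iff]
  intro g hg
  rw [Fintype.sum_option] at hg
  have h1 : ∀ j, g (some j) = 0 := by
    intro j
    have := congrArg (fun x => (Prod.fst x) j) hg
    simpa [homogenize, simplexPoint, Prod.fst_sum, Finset.sum_apply, Pi.single_apply] using this
  have h2 := congrArg Prod.snd hg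
  simp only [h1, homogenize] at h2
  rintro (_ | i)
  · simpa using h2
  · exact h1 i

lemma rk_simplexPoint (d : ℕ) :
    rk (homogenize (simplexPoint d)) Finset.univ = d + 1 := by
  rw [rk_eq_card (linearIndependent_simplexPoint d), Finset.card_univ, Fintype.card_option,
    Fintype.card_fin]

/-- A `k`-dimensional face of a `d`-dimensional simplex has at most `(k + 1) * (d - k)`
neighbors. -/
lemma le_of_isVertexConnected_simplex {k d m : ℕ}
    (h : IsVertexConnected
      (faceGraph (convexHull ℝ (Set.range (simplexPoint d))) k) m) :
    m ≤ (k + 1) * (d - k) := by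
  have hlin := linearIndependent_simplexPoint d
  obtain ⟨F⟩ : Nonempty
      {F // IsFaceOfDim (convexHull ℝ (Set.range (simplexPoint d))) k F} := by
    by_contra hemp
    rw [not_nonempty_iff] at hemp
    have := h.1
    rw [ENat.card_eq_zero_iff_empty _ |>.2 hemp] at this
    simp at this
  set S := indices (simplexPoint d) F.1 with hS
  have hSc : S.card = k + 1 := by rw [← rk_eq_card hlin, (IsFaceOfDim.face F.2).2.1]
  -- Neighbors arise by exchanging one of `k + 1` vertices for one of the other `d - k`.
  set N := (S ×ˢ Sᶜ).image fun x => insert x.2 (S.erase x.1) with hN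
  have hNc : N.card ≤ (k + 1) * (d - k) := by
    refine Finset.card_image_le.trans ?_
    rw [Finset.card_product, Finset.card_compl, hSc, Fintype.card_option, Fintype.card_fin]
    exact Nat.mul_le_mul_left _ (by omega)
  refine (le_card_of_neighbors h indices_injective N (x := F) ?_ ?_).trans hNc
  · intro hmem
    obtain ⟨⟨a, b⟩, hab, heq⟩ := Finset.mem_image.1 hmem
    rw [Finset.mem_product, Finset.mem_compl] at hab
    exact hab.2 ((show insert b (S.erase a) = S from heq) ▸ Finset.mem_insert_self _ _)
  · intro G hFG
    obtain ⟨hne, H, hH, hr, h1, h2⟩ := faceGraph_adj_iff.1 hFG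
    set T := indices (simplexPoint d) G.1 with hT
    have hTc : T.card = k + 1 := by rw [← rk_eq_card hlin, (IsFaceOfDim.face G.2).2.1]
    rw [rk_eq_card hlin] at hr
    have hST : S ≠ T := fun heq => hne (indices_injective heq)
    obtain ⟨b, hbT, hbS⟩ := Finset.not_subset.1 fun hsub : T ⊆ S =>
      hST (Finset.eq_of_subset_of_card_le hsub (by omega)).symm
    obtain ⟨a, haS, haT⟩ := Finset.not_subset.1 fun hsub : S ⊆ T =>
      hST (Finset.eq_of_subset_of_card_le hsub (by omega))
    refine Finset.mem_image.2 ⟨(a, b), by simp [haS, hbS], ?_⟩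
    have hHS : insert b S = H := Finset.eq_of_subset_of_card_le
      (Finset.insert_subset (h2 hbT) h1) (by rw [Finset.card_insert_of_notMem hbS]; omega)
    refine (Finset.eq_of_subset_of_card_le (fun i hi => ?_) ?_).symm
    · have hiH : i ∈ insert b S := hHS ▸ h2 hi
      rw [Finset.mem_insert] at hiH ⊢
      exact hiH.imp_right fun hiS => Finset.mem_erase.2 ⟨fun h : i = a => haT (h ▸ hi), hiS⟩
    · refine (Finset.card_insert_le _ _).trans ?_
      rw [Finset.card_erase_of_mem haS]
      omega

/-- The unit vectors, the origin and the all-ones vector: the vertices of a bipyramid over a simplex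
whose apexes are the last two. -/
noncomputable def bipyramidPoint (d : ℕ) : Option (Option (Fin d)) → EuclideanSpace ℝ (Fin d)
  | none => WithLp.toLp 2 fun _ => 1
  | some i => simplexPoint d i

lemma rk_bipyramidPoint_image (d : ℕ) (T : Finset (Option (Fin d))) :
    rk (homogenize (bipyramidPoint d)) (T.image some) = T.card := by
  rw [← rk_eq_card (linearIndependent_simplexPoint d), rk, rk, Finset.coe_image, ← Set.image_comp]
  rfl

lemma rk_bipyramidPoint (d : ℕ) :
    rk (homogenize (bipyramidPoint d)) Finset.univ = d + 1 := by
  apply le_antisymm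
  · refine (Submodule.finrank_le _).trans ?_
    simp
  · have := rk_mono (v := homogenize (bipyramidPoint d))
      (Finset.subset_univ ((Finset.univ : Finset (Option (Fin d))).image some))
    rwa [rk_bipyramidPoint_image, Finset.card_univ, Fintype.card_option, Fintype.card_fin] at this

/-- The sum of the coordinates, as a functional on the homogenization. -/
noncomputable def coordSum (d : ℕ) : Dual ℝ (EuclideanSpace ℝ (Fin d) × ℝ) :=
  (∑ i, (EuclideanSpace.proj i : EuclideanSpace ℝ (Fin d) →L[ℝ] ℝ).toLinearMap).comp
    (LinearMap.fst ℝ _ ℝ)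

lemma coordSum_bipyramidPoint (d : ℕ) :
    coordSum d (homogenize (bipyramidPoint d) none) = d ∧
    coordSum d (homogenize (bipyramidPoint d) (some none)) = 0 ∧
    ∀ i, coordSum d (homogenize (bipyramidPoint d) (some (some i))) = 1 := by
  refine ⟨?_, ?_, fun i => ?_⟩ <;>
  simp [coordSum, homogenize, bipyramidPoint, simplexPoint]

lemma face_origin_bipyramid {d : ℕ} (hd : 2 ≤ d) :
    Face (homogenize (bipyramidPoint d)) {some none} := by
  obtain ⟨h1, h2, h3⟩ := coordSum_bipyramidPoint d
  refine ⟨coordSum d, ?_, ?_⟩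
  · rintro (_ | _ | i) <;> simp [h1, h2, h3]
  · rintro (_ | _ | i)
    · simp only [h1]; simp; omega
    · simp [h2]
    · simp [h3]

lemma face_apex_bipyramid {d : ℕ} (hd : 2 ≤ d) :
    Face (homogenize (bipyramidPoint d)) {none} := by
  obtain ⟨h1, h2, h3⟩ := coordSum_bipyramidPoint d
  have hd' : (2 : ℝ) ≤ d := by exact_mod_cast hd
  have hsnd : ∀ i, LinearMap.snd ℝ (EuclideanSpace ℝ (Fin d)) ℝ
      (homogenize (bipyramidPoint d) i) = 1 := fun _ => rfl
  refine ⟨(d : ℝ) • LinearMap.snd ℝ _ ℝ - coordSum d, ?_, ?_⟩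
  · rintro (_ | _ | i) <;>
    simp only [LinearMap.sub_apply, LinearMap.smul_apply, hsnd, h1, h2, h3, smul_eq_mul] <;>
    linarith
  · rintro (_ | _ | i) <;>
    simp only [LinearMap.sub_apply, LinearMap.smul_apply, hsnd, h1, h2, h3, smul_eq_mul]
    · simp
    · simp; omega
    · simp; intro h; linarith

lemma eq_univ_of_mem_bipyramid {d : ℕ} {S : Finset (Option (Option (Fin d)))}
    (hS : Face (homogenize (bipyramidPoint d)) S) (h0 : some none ∈ S) (h1 : none ∈ S) :
    S = Finset.univ := by
  obtain ⟨f, hf, hfS⟩ := hS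
  -- The segment between the apexes crosses the base at its barycenter, so a face containing both
  -- apexes contains every base vertex.
  have hsum : ∑ i : Fin d, homogenize (bipyramidPoint d) (some (some i)) =
      homogenize (bipyramidPoint d) none +
        ((d : ℝ) - 1) • homogenize (bipyramidPoint d) (some none) := by
    ext j
    · simp [homogenize, bipyramidPoint, simplexPoint, Prod.fst_sum, Pi.single_apply]
    · simp [homogenize, Prod.snd_sum]
  have h2 := congrArg f hsum
  rw [map_sum, map_add, map_smul, (hfS _).1 h0, (hfS _).1 h1, smul_zero, add_zero,
    Finset.sum_eq_zero_iff_of_nonneg fun i _ => hf _] at h2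
  rw [Finset.eq_univ_iff_forall]
  rintro (_ | _ | i)
  · exact h1
  · exact h0
  · exact (hfS _).2 (h2 i (Finset.mem_univ i))

/-- The `d` ridges of a bipyramid over a simplex that contain neither apex separate the ridges
through one apex from those through the other. -/
lemma le_of_isVertexConnected_bipyramid {k d m : ℕ} (hk : k + 2 = d)
    (h : IsVertexConnected
      (faceGraph (convexHull ℝ (Set.range (bipyramidPoint d))) k) m) : m ≤ d := by
  have hd : 2 ≤ d := by omega
  set p := bipyramidPoint d with hp
  have hr : rk (homogenize p) Finset.univ = d + 1 := rk_bipyramidPoint d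
  set N : Finset (Finset (Option (Option (Fin d)))) :=
    ((Finset.univ : Finset (Fin d)).powersetCard (k + 1)).image fun T =>
      (T.image some).image some with hN
  have hNc : N.card ≤ d := by
    refine Finset.card_image_le.trans ?_
    rw [Finset.card_powersetCard, Finset.card_univ, Fintype.card_fin, ← hk,
      Nat.choose_succ_self_right]
  have hmemN : ∀ S, Face (homogenize p) S → rk (homogenize p) S = k + 1 → S ∉ N →
      some none ∈ S ∨ none ∈ S := by
    intro S hS hrS hSN
    by_contra! hcon
    set T : Finset (Fin d) := Finset.univ.filter fun i => some (some i) ∈ S with hT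
    have hST : S = (T.image some).image some := by
      ext (_ | _ | i)
      · simpa using hcon.2
      · simpa using hcon.1
      · simp [hT]
    refine hSN (Finset.mem_image.2 ⟨T, Finset.mem_powersetCard.2 ⟨Finset.subset_univ _, ?_⟩,
      hST.symm⟩)
    rw [hST, rk_bipyramidPoint_image, Finset.card_image_of_injective _ (Option.some_injective _)]
      at hrS
    exact hrS
  have hex : ∀ a, Face (homogenize p) {a} → ∃ F : {F // IsFaceOfDim (convexHull ℝ (Set.range p))
      k F}, a ∈ indices p F.1 := by
    intro a ha
    have hra : rk (homogenize p) {a} = 1 := by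
      rw [rk, Finset.coe_singleton, Set.image_singleton, finrank_span_singleton]
      intro h0
      simpa [homogenize] using congrArg Prod.snd h0
    -- The count is used only for its positivity: some `k`-face passes through the apex `a`.
    have h1 := choose_le_card_facesBetween d k {a} Finset.univ ha face_univ
      (Finset.subset_univ _) (by omega)
    obtain ⟨S, hS⟩ := Finset.card_pos.1 ((Nat.choose_pos (by omega)).trans_le h1)
    obtain ⟨g1, g2, -, g3⟩ := mem_facesBetween.1 hS
    refine ⟨(faceEquiv p k).symm ⟨S, g1, by omega⟩, ?_⟩
    have := congrArg Subtype.val ((faceEquiv p k).apply_symm_apply ⟨S, g1, by omega⟩)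
    rw [show indices p _ = S from this]
    exact g2 (Finset.mem_singleton_self a)
  have huniv : ∀ S, Face (homogenize p) S → rk (homogenize p) S < d + 1 → some none ∈ S →
      none ∉ S := by
    intro S hS hrS h0 h1
    rw [eq_univ_of_mem_bipyramid hS h0 h1] at hrS
    omega
  obtain ⟨F, hF⟩ := hex _ (face_origin_bipyramid hd)
  obtain ⟨G, hG⟩ := hex _ (face_apex_bipyramid hd)
  have hGf := IsFaceOfDim.face G.2
  refine (le_card_of_separates h indices_injective N (fun F => some none ∈ indices p F.1)
    (x := F) (y := G) ?_ ?_ hF ?_ ?_).trans hNc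
  · intro hmem
    obtain ⟨T, -, hT⟩ := Finset.mem_image.1 hmem
    rw [← hT] at hF
    simp at hF
  · intro hmem
    obtain ⟨T, -, hT⟩ := Finset.mem_image.1 hmem
    rw [← hT] at hG
    simp at hG
  · exact fun h0 => huniv _ hGf.1 (by omega) h0 hG
  · intro A B hAB hA hB h0
    obtain ⟨-, H, hH, hrH, h1, h2⟩ := faceGraph_adj_iff.1 hAB
    have hBf := IsFaceOfDim.face B.2
    rcases hmemN _ hBf.1 hBf.2.1 hB with h3 | h3
    · exact h3
    · exact absurd (h2 h3) (huniv H hH (by omega) (h1 h0))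

end UpperBounds

end VectorConfiguration

open VectorConfiguration in
theorem theorem1p1 (k d : ℕ) (hkd : k < d) :
    IsGreatest
      {m : ℕ | 0 < m ∧ ∀ (N : ℕ) (P : Set (EuclideanSpace ℝ (Fin N))),
        PolytopeGraph.IsPolytope P → PolytopeGraph.HasDim P d →
          PolytopeGraph.IsVertexConnected (PolytopeGraph.faceGraph P k) m}
      (if k + 2 = d then d else (k + 1) * (d - k)) := by
  refine ⟨⟨bound_pos hkd, fun N P hP hd => isVertexConnected_faceGraph hP hd hkd⟩, ?_⟩
  rintro m ⟨-, hm⟩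
  split_ifs with h
  · exact le_of_isVertexConnected_bipyramid h
      (hm d _ ⟨_, Set.finite_range _, rfl⟩ (hasDim_of_rk (rk_bipyramidPoint d)))
  · exact le_of_isVertexConnected_simplex
      (hm d _ ⟨_, Set.finite_range _, rfl⟩ (hasDim_of_rk (rk_simplexPoint d)))
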